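/- Theorem 1.2 (Gaussianity on small intervals). Let $L\ge 1$ and let $c_1\ge c_2\ge\cdots\ge c_L\ge 1$ be integers. Let $\{G_n\}_{n\ge1}$ be the positive linear recurrence sequence of positive integers given by $G_1=1$, $$G_{n+1}=c_1G_n+c_2G_{n-1}+\cdots+c_nG_1+1\quad(1\le n<L),\qquad G_{n+1}=c_1G_n+\cdots+c_LG_{n+1-L}\quad(n\ge L).$$ A finite sequence $(a_1,\dots,a_k)$ of non-negative integers is called legal if it is empty, or if $a_1>0$ and one of the following holds: (1) $k<L$ and $a_i=c_i$ for $1\le i\le k$; (2) there are $s\in\{1,\dots,L\}$ and $\ell\ge0$ with $s+\ell\le k$ such that $a_i=c_i$ for $1\le i<s$, $a_s<c_s$, $a_{s+1}=\cdots=a_{s+\ell}=0$, and $(a_{s+\ell+1},\dots,a_k)$ is legal. A legal decomposition of a positive integer $N$ is an expression $N=\sum_{i=1}^k a_iG_{k+1-i}$ with $(a_1,\dots,a_k)$ legal. If $(L,c_1)\neq(1,1)$, every positive integer $N$ has exactly one legal decomposition, and $s(N)=a_1+\cdots+a_k$ denotes its number of summands. (If $L=c_1=1$, the intervals $[G_n,G_{n+1})$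 are empty and nothing is asserted.) Intervals are intervals of integers. Let $\alpha(n)$ be non-negative integers with $\alpha(n)\to\infty$ and $n-\alpha(n)\to\infty$ as $n\to\infty$. Then for almost all $m\in[G_n,G_{n+1})$, the number of summands of the integers in $[m,m+G_{\alpha(n)})$, normalized by its mean and standard deviation, converges in distribution to the standard normal. Precisely, there are exceptional sets $E_n\subseteq[G_n,G_{n+1})$ with $|E_n|=o(G_{n+1}-G_n)$ such that for every sequence $(m_n)$ with $m_n\in[G_n,G_{n+1})\setminus E_n$ for all large $n$, and every $t\in\mathbb R$, $$\lim_{n\to\infty}\frac{1}{G_{\alpha(n)}}\,\#\Bigl\{x\in[m_n,m_n+G_{\alpha(n)}):\ \frac{s(x)-\mu_n}{\sigma_n}\le t\Bigr\}=\frac1{\sqrt{2\pi}}\int_{-\infty}^t e^{-u^2/2}\,du,$$ where $\mu_n$ and $\sigma_n$ are the mean and the standard deviation of $s(x)$ for $x$ uniformly distributed on $[m_n,m_n+G_{\alpha(n)})$ (and $\sigma_n>0$ for all large $n$). -/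

import Mathlib

open Filter Topology Finset Asymptotics

/-- `G 1, G 2, …` is a positive linear recurrence sequence with coefficients `c 1, …, c L`.
All sequences are indexed from `1`; the values `G 0`, `c 0` and `c i` for `i > L` play no role. -/
structure IsPLRS (L : ℕ) (c G : ℕ → ℕ) : Prop where
  length_pos : 0 < L
  first_coeff_pos : 0 < c 1
  last_coeff_pos : 0 < c L
  pos : ∀ n, 1 ≤ n → 0 < G n
  recurrence : ∀ n, L ≤ n → G (n + 1) = ∑ i ∈ Icc 1 L, c i * G (n + 1 - i)
  one : G 1 = 1
  initial : ∀ n, 1 ≤ n → n < L → G (n + 1) = (∑ i ∈ Icc 1 n, c i * G (n + 1 - i)) + 1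

/-- `IsLegal L c k a` : the finite sequence `a 1, …, a k` (most significant coefficient first) is
legal with respect to the coefficients `c 1, …, c L`. The empty sequence is allowed, so that the
recursion in `cond2` can end; a nonempty legal sequence has `a 1 > 0`. -/
inductive IsLegal (L : ℕ) (c : ℕ → ℕ) : ℕ → (ℕ → ℕ) → Prop where
  | empty (a : ℕ → ℕ) : IsLegal L c 0 a
  | cond1 (k : ℕ) (a : ℕ → ℕ) (hk : 1 ≤ k) (ha : 0 < a 1) (hkL : k < L)
      (heq : ∀ i, 1 ≤ i → i ≤ k → a i = c i) : IsLegal L c k a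
  | cond2 (k : ℕ) (a : ℕ → ℕ) (s l : ℕ) (ha : 0 < a 1) (hs : 1 ≤ s) (hsL : s ≤ L)
      (hk : s + l ≤ k)
      (heq : ∀ i, 1 ≤ i → i < s → a i = c i) (hlt : a s < c s)
      (hzero : ∀ i, s < i → i ≤ s + l → a i = 0)
      (hrest : IsLegal L c (k - s - l) (fun i => a (s + l + i))) : IsLegal L c k a

/-- `r` is the number of summands of a legal decomposition
`N = a 1 * G k + a 2 * G (k - 1) + ⋯ + a k * G 1`. -/
def IsNumSummands (L : ℕ) (c G : ℕ → ℕ) (N r : ℕ) : Prop :=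
  ∃ (k : ℕ) (a : ℕ → ℕ), IsLegal L c k a ∧
    N = ∑ i ∈ Icc 1 k, a i * G (k + 1 - i) ∧ r = ∑ i ∈ Icc 1 k, a i

/-- The number of summands of the legal decomposition of `N`. A positive integer has exactly one
legal decomposition (unless `L = c 1 = 1`, when `G` is constant), so the set below is a singleton. -/
noncomputable def numSummands (L : ℕ) (c G : ℕ → ℕ) (N : ℕ) : ℕ :=
  sInf {r | IsNumSummands L c G N r}

/-- Mean of `f x` for `x` uniform in the integer interval `[m, m + H)`. -/
noncomputable def intervalMean (f : ℕ → ℝ) (m H : ℕ) : ℝ :=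
  (∑ x ∈ Ico m (m + H), f x) / H

/-- Standard deviation of `f x` for `x` uniform in the integer interval `[m, m + H)`. -/
noncomputable def intervalStdDev (f : ℕ → ℝ) (m H : ℕ) : ℝ :=
  √(intervalMean (fun x => (f x - intervalMean f m H) ^ 2) m H)

open Classical in
/-- The cumulative distribution function of `(f x - mean) / (standard deviation)` for `x` uniform
in the integer interval `[m, m + H)`. -/
noncomputable def normalizedCDF (f : ℕ → ℝ) (m H : ℕ) (t : ℝ) : ℝ :=
  (#{x ∈ Ico m (m + H) | (f x - intervalMean f m H) / intervalStdDev f m H ≤ t} : ℝ) / H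

/-! Because the coefficients do not increase, legal decompositions are the greedy ones, so `s` is
`greedyCount` (`numSummands_eq`). The integers whose expansion starts with a fixed prefix form
cylinders `[Y, Y + G (k + 1))`, on which `s (Y + t) = s Y + s t`. Two consequences of this
additivity drive the proof.

On initial segments: splitting `[0, G (k + 1))` by the first block gives `∑ exp (τ s(x))` an
`L`-term recursion in `k`. After division by `ρ ^ (-k) exp ((μ τ + σ² τ² / 2) k)` its weights tend
to a probability vector as `τ → 0`, and their total is `1 + O(τ³)`. For `τ` of order `N^(-1/2)` the
errors in the total are negligible over `N` steps, and the solution tends to the limit of the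
unperturbed renewal equation (`tendsto_perturbed_renewal`). This gives Gaussian asymptotics for
complex `τ` (`exists_quasiPower`).

On windows: let a window of length `G (a + 1)` lie in a cylinder of level at most `a + q`, with `q →
∞` and `q = o(√a)`. Translation by the base point `Y` only adds the constant `s Y`. Cut the
translated window into cylinders of level about `a - q`. Their prefixes contribute `O(q) = o(√a)` to
`s`, each cylinder is asymptotically Gaussian with the same parameters, and the cylinders cut by an
endpoint carry a vanishing proportion (`tendsto_windowTransform`). The exceptional set consists of
the starting points whose window lies in no such cylinder; its proportion is about `G (a + 1) / G (a
+ q)`, which tends to zero.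

Convergence is locally uniform in a complex argument, so derivatives at `0` converge too. This
identifies the actual mean and variance of the window, and Lévy's continuity theorem concludes
(`tendsto_normalizedCDF`). -/

/-- A positive linear recurrence sequence with non-increasing coefficients which is strictly
increasing, i.e. which is not constant. -/
structure IsMonotonePLRS (L : ℕ) (c G : ℕ → ℕ) : Prop extends IsPLRS L c G where
  anti : ∀ i j, 1 ≤ i → i ≤ j → j ≤ L → c j ≤ c i
  lt_succ : ∀ n, 1 ≤ n → G n < G (n + 1)

/-! ### Legal decompositions, the greedy algorithm and cylinders -/

theorem sum_Icc_one_eq_sum_range {M : Type*} [AddCommMonoid M] (f : ℕ → M) (k : ℕ) :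
    ∑ i ∈ Icc 1 k, f i = ∑ i ∈ range k, f (i + 1) := by
  rw [Finset.range_eq_Ico, Finset.sum_Ico_add' f 0 k 1]
  rfl

/-- The value of the digit sequence `a 1, …, a k`. -/
def digitValue (G : ℕ → ℕ) (k : ℕ) (a : ℕ → ℕ) : ℕ := ∑ i ∈ range k, a (i + 1) * G (k - i)

/-- The number of summands that the greedy algorithm uses. -/
noncomputable def greedyCount (G : ℕ → ℕ) (N : ℕ) : ℕ :=
  if h : 0 < N ∧ 0 < G (Nat.findGreatest (fun k => 1 ≤ k ∧ G k ≤ N) N) then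
    greedyCount G (N - G (Nat.findGreatest (fun k => 1 ≤ k ∧ G k ≤ N) N)) + 1
  else 0
termination_by N
decreasing_by exact Nat.sub_lt h.1 h.2

theorem greedyCount_zero (G : ℕ → ℕ) : greedyCount G 0 = 0 := by
  rw [greedyCount]; simp

theorem IsPLRS.lt_succ_of_ne {L : ℕ} {c G : ℕ → ℕ} (hG : IsPLRS L c G)
    (hc : ∀ i, 1 ≤ i → i ≤ L → 1 ≤ c i) (hne : ¬ (L = 1 ∧ c 1 = 1)) (n : ℕ) (hn : 1 ≤ n) :
    G n < G (n + 1) := by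
  rcases lt_or_ge n L with h | h
  · rw [hG.initial n hn h, Nat.lt_succ_iff]
    calc G n ≤ c 1 * G (n + 1 - 1) := by
          simpa using Nat.le_mul_of_pos_left (G n) hG.first_coeff_pos
      _ ≤ _ := single_le_sum (f := fun i => c i * G (n + 1 - i)) (fun _ _ => Nat.zero_le _)
          (by simp [hn])
  · rw [hG.recurrence n h]
    rcases Nat.lt_or_ge 1 L with hL | hL
    · have hsub : ({1, 2} : Finset ℕ) ⊆ Icc 1 L := by
        intro x; simp only [mem_insert, mem_singleton, mem_Icc]; omega
      have := sum_le_sum_of_subset (f := fun i => c i * G (n + 1 - i)) hsub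
      refine lt_of_lt_of_le ?_ this
      rw [sum_pair (by norm_num)]
      have h1 := hG.first_coeff_pos
      have h2 := hc 2 (by norm_num) hL
      have h3 := hG.pos (n - 1) (by omega)
      have e1 : n + 1 - 1 = n := by omega
      have e2 : n + 1 - 2 = n - 1 := by omega
      simp only [e1, e2]
      nlinarith [hG.pos n hn]
    · have : L = 1 := le_antisymm hL hG.length_pos
      subst this
      have h1 := hG.first_coeff_pos
      have h2 : 2 ≤ c 1 := by
        have : c 1 ≠ 1 := fun h => hne ⟨rfl, h⟩
        omega
      simp only [Icc_self, sum_singleton, Nat.add_sub_cancel]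
      nlinarith [hG.pos n hn]

namespace IsMonotonePLRS

variable {L : ℕ} {c G : ℕ → ℕ}

theorem coeff_pos (h : IsMonotonePLRS L c G) {i : ℕ} (hi : 1 ≤ i) (hL : i ≤ L) : 0 < c i :=
  lt_of_lt_of_le h.last_coeff_pos (h.anti i L hi hL le_rfl)

theorem lt_of_lt (h : IsMonotonePLRS L c G) {a b : ℕ} (ha : 1 ≤ a) (hab : a < b) : G a < G b := by
  induction b, hab using Nat.le_induction with
  | base => exact h.lt_succ a ha
  | succ n hn ih => exact ih.trans (h.lt_succ n (by omega))

theorem le_of_le (h : IsMonotonePLRS L c G) {a b : ℕ} (ha : 1 ≤ a) (hab : a ≤ b) : G a ≤ G b := by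
  rcases hab.eq_or_lt with rfl | hlt
  · rfl
  · exact (h.lt_of_lt ha hlt).le

theorem self_le (h : IsMonotonePLRS L c G) {a : ℕ} (ha : 1 ≤ a) : a ≤ G a := by
  induction a, ha using Nat.le_induction with
  | base => rw [h.one]
  | succ n hn ih => have := h.lt_succ n hn; omega

theorem recurrence_range (h : IsMonotonePLRS L c G) {k : ℕ} (hk : L ≤ k) :
    G (k + 1) = ∑ i ∈ range L, c (i + 1) * G (k - i) := by
  rw [h.recurrence k hk, sum_Icc_one_eq_sum_range]
  simp

theorem initial_range (h : IsMonotonePLRS L c G) {k : ℕ} (hk : k < L) :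
    G (k + 1) = ∑ i ∈ range k, c (i + 1) * G (k - i) + 1 := by
  rcases Nat.eq_zero_or_pos k with rfl | hk0
  · simp [h.one]
  rw [h.initial k hk0 hk, sum_Icc_one_eq_sum_range]
  simp

/-- Shifting the coefficients by `d` can only decrease them, so the sum is dominated by the one
defining `G (k + 1)`. This is how monotonicity makes blocks greedy: what remains of a block after
`d` digits never reaches the next larger term. -/
theorem sum_le (h : IsMonotonePLRS L c G) {k n d : ℕ} (hnk : n ≤ k) (hnL : d + n ≤ L) :
    ∑ i ∈ range n, c (d + i + 1) * G (k - i) ≤ G (k + 1) := by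
  have h1 : ∑ i ∈ range n, c (d + i + 1) * G (k - i) ≤ ∑ i ∈ range n, c (i + 1) * G (k - i) := by
    refine sum_le_sum fun i hi => Nat.mul_le_mul_right _ (h.anti _ _ (by omega) (by omega) ?_)
    have := mem_range.1 hi; omega
  refine h1.trans ?_
  rcases lt_or_ge k L with hk | hk
  · rw [h.initial_range hk]
    exact (sum_le_sum_of_subset (range_mono hnk)).trans (Nat.le_succ _)
  · rw [h.recurrence_range hk]
    exact sum_le_sum_of_subset (range_mono (by omega))

theorem sum_lt (h : IsMonotonePLRS L c G) {k d : ℕ} (hk : k < L) (hdL : d + k ≤ L) :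
    ∑ i ∈ range k, c (d + i + 1) * G (k - i) < G (k + 1) := by
  rw [h.initial_range hk, Nat.lt_succ_iff]
  refine sum_le_sum fun i hi => Nat.mul_le_mul_right _ (h.anti _ _ (by omega) (by omega) ?_)
  have := mem_range.1 hi; omega

theorem greedyCount_eq (h : IsMonotonePLRS L c G) {k N : ℕ} (hk : 1 ≤ k) (h1 : G k ≤ N)
    (h2 : N < G (k + 1)) : greedyCount G N = greedyCount G (N - G k) + 1 := by
  have hidx : Nat.findGreatest (fun k => 1 ≤ k ∧ G k ≤ N) N = k := by
    rw [Nat.findGreatest_eq_iff]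
    refine ⟨(h.self_le hk).trans h1, fun _ => ⟨hk, h1⟩, fun n hn _ hc => ?_⟩
    have := h.le_of_le (show 1 ≤ k + 1 by omega) hn
    omega
  have hpos := h.pos k hk
  rw [greedyCount, dif_pos]
  · rw [hidx]
  · rw [hidx]; exact ⟨by omega, hpos⟩

theorem greedyCount_mul_add (h : IsMonotonePLRS L c G) {k y : ℕ} (hk : 1 ≤ k) :
    ∀ j, j * G k + y < G (k + 1) → greedyCount G (j * G k + y) = j + greedyCount G y
  | 0, _ => by simp
  | j + 1, hj => by
    have e : (j + 1) * G k + y - G k = j * G k + y := by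
      rw [Nat.succ_mul]; omega
    rw [h.greedyCount_eq hk (by rw [Nat.succ_mul]; omega) hj, e,
      h.greedyCount_mul_add hk j (by rw [Nat.succ_mul] at hj; omega)]
    omega

/-- The greedy algorithm first removes `c (d + 1)` copies of `G K`, leaving the same situation with
`d + 1` and `K - 1`; the offset `d` is there for this induction. The alternatives for `R` correspond
to `cond2` (a smaller digit follows the prefix) and `cond1` (the prefix is the whole sequence). -/
theorem greedyCount_prefix (h : IsMonotonePLRS L c G) (n : ℕ) : ∀ (K d R : ℕ), d + n ≤ L →
    (d + n < L ∧ n < K ∧ R < c (d + n + 1) * G (K - n)) ∨ (R = 0 ∧ n = K ∧ n < L) →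
    ∑ i ∈ range n, c (d + i + 1) * G (K - i) + R < G (K + 1) ∧
    greedyCount G (∑ i ∈ range n, c (d + i + 1) * G (K - i) + R) =
      ∑ i ∈ range n, c (d + i + 1) + greedyCount G R := by
  induction n with
  | zero =>
    rintro K d R hd (⟨h1, h2, h3⟩ | ⟨rfl, rfl, _⟩)
    · have := h.sum_le (k := K) (n := 1) (d := d) h2 h1
      simp only [sum_range_succ, range_zero, sum_empty] at this ⊢
      simp only [Nat.add_zero, Nat.sub_zero, Nat.zero_add] at this h3 ⊢
      exact ⟨by omega, trivial⟩
    · simp [h.one]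
  | succ n ih =>
    intro K d R hd hR
    have hlt : ∑ i ∈ range (n + 1), c (d + i + 1) * G (K - i) + R < G (K + 1) := by
      rcases hR with ⟨h1, h2, h3⟩ | ⟨rfl, rfl, h3⟩
      · have := h.sum_le (k := K) (n := n + 1 + 1) (d := d) h2 h1
        rw [sum_range_succ] at this
        rw [← Nat.add_assoc] at *
        omega
      · exact h.sum_lt h3 hd
    refine ⟨hlt, ?_⟩
    obtain ⟨-, ih2⟩ := ih (K - 1) (d + 1) R (by omega) (by
      rcases hR with ⟨h1, h2, h3⟩ | ⟨h1, h2, h3⟩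
      · refine Or.inl ⟨by omega, by omega, ?_⟩
        rwa [show d + 1 + n + 1 = d + (n + 1) + 1 by omega, show K - 1 - n = K - (n + 1) by omega]
      · exact Or.inr ⟨h1, by omega, by omega⟩)
    have hK : 1 ≤ K := by rcases hR with ⟨h1, h2, h3⟩ | ⟨h1, h2, h3⟩ <;> omega
    have e1 : ∑ i ∈ range (n + 1), c (d + i + 1) * G (K - i) + R = c (d + 1) * G K +
        (∑ i ∈ range n, c (d + 1 + i + 1) * G (K - 1 - i) + R) := by
      rw [sum_range_succ']
      have : ∀ i, c (d + (i + 1) + 1) * G (K - (i + 1)) = c (d + 1 + i + 1) * G (K - 1 - i) := by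
        intro i
        rw [show d + (i + 1) + 1 = d + 1 + i + 1 by omega, show K - (i + 1) = K - 1 - i by omega]
      simp only [this, Nat.add_zero, Nat.sub_zero]
      omega
    have e2 : ∑ i ∈ range (n + 1), c (d + i + 1) = c (d + 1) +
        ∑ i ∈ range n, c (d + 1 + i + 1) := by
      rw [sum_range_succ']
      have : ∀ i, c (d + (i + 1) + 1) = c (d + 1 + i + 1) := by
        intro i
        rw [show d + (i + 1) + 1 = d + 1 + i + 1 by omega]
      simp only [this, Nat.add_zero]
      omega
    rw [e1] at hlt
    rw [e1, e2, h.greedyCount_mul_add hK _ hlt, ih2]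
    omega

/-- On the cylinder of the prefix `c 1, …, c n, j` the greedy count splits additively. -/
theorem greedyCount_cylinder (h : IsMonotonePLRS L c G) {n k j t : ℕ} (hn : n < L) (hnk : n < k)
    (hj : j < c (n + 1)) (ht : t < G (k - n)) :
    ∑ i ∈ range n, c (i + 1) * G (k - i) + (j * G (k - n) + t) < G (k + 1) ∧
    greedyCount G (∑ i ∈ range n, c (i + 1) * G (k - i) + (j * G (k - n) + t)) =
      ∑ i ∈ range n, c (i + 1) + j + greedyCount G t := by
  have hR : j * G (k - n) + t < c (n + 1) * G (k - n) := by
    calc _ < (j + 1) * G (k - n) := by rw [Nat.succ_mul]; omega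
      _ ≤ _ := Nat.mul_le_mul_right _ hj
  have hp := h.greedyCount_prefix n k 0 (j * G (k - n) + t) (by omega)
    (Or.inl ⟨by omega, hnk, by simpa using hR⟩)
  simp only [Nat.zero_add] at hp
  refine ⟨hp.1, ?_⟩
  have hb := h.sum_le (k := k - n) (n := 1) (d := n) (by omega) (by omega)
  simp only [range_one, sum_singleton, Nat.add_zero, Nat.sub_zero] at hb
  rw [hp.2, h.greedyCount_mul_add (by omega) _ (hR.trans_le hb)]
  omega

end IsMonotonePLRS

theorem digitValue_split {G : ℕ → ℕ} {a c : ℕ → ℕ} {n l k : ℕ}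
    (heq : ∀ i, 1 ≤ i → i < n + 1 → a i = c i)
    (hzero : ∀ i, n + 1 < i → i ≤ n + 1 + l → a i = 0) :
    digitValue G (n + 1 + l + k) a = ∑ i ∈ range n, c (i + 1) * G (n + 1 + l + k - i) +
      (a (n + 1) * G (n + 1 + l + k - n) + digitValue G k (fun i => a (n + 1 + l + i))) := by
  unfold digitValue
  rw [sum_range_add, sum_range_add, sum_range_succ]
  have h1 : ∑ i ∈ range n, a (i + 1) * G (n + 1 + l + k - i) =
      ∑ i ∈ range n, c (i + 1) * G (n + 1 + l + k - i) :=
    sum_congr rfl fun i hi => by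
      have := mem_range.1 hi
      rw [heq (i + 1) (by omega) (by omega)]
  have h2 : ∑ i ∈ range l, a (n + 1 + i + 1) * G (n + 1 + l + k - (n + 1 + i)) = 0 :=
    sum_eq_zero fun i hi => by
      have := mem_range.1 hi
      rw [hzero _ (by omega) (by omega), Nat.zero_mul]
  have h3 : ∀ i, n + 1 + l + k - (n + 1 + l + i) = k - i := fun i => by omega
  simp only [h1, h2, h3]
  rw [Nat.add_zero, Nat.add_assoc]
  rfl

theorem digitSum_split {a c : ℕ → ℕ} {n l k : ℕ}
    (heq : ∀ i, 1 ≤ i → i < n + 1 → a i = c i)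
    (hzero : ∀ i, n + 1 < i → i ≤ n + 1 + l → a i = 0) :
    ∑ i ∈ range (n + 1 + l + k), a (i + 1) = ∑ i ∈ range n, c (i + 1) + a (n + 1) +
      ∑ i ∈ range k, a (n + 1 + l + (i + 1)) := by
  rw [sum_range_add, sum_range_add, sum_range_succ]
  have h1 : ∑ i ∈ range n, a (i + 1) = ∑ i ∈ range n, c (i + 1) :=
    sum_congr rfl fun i hi => by
      have := mem_range.1 hi
      rw [heq (i + 1) (by omega) (by omega)]
  have h2 : ∑ i ∈ range l, a (n + 1 + i + 1) = 0 :=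
    sum_eq_zero fun i hi => by
      have := mem_range.1 hi
      rw [hzero _ (by omega) (by omega)]
  simp only [h1, h2, Nat.add_zero]
  rfl

theorem IsLegal.congr {L : ℕ} {c : ℕ → ℕ} {k : ℕ} {a : ℕ → ℕ} (ha : IsLegal L c k a) :
    ∀ {b : ℕ → ℕ}, (∀ i, 1 ≤ i → i ≤ k → a i = b i) → IsLegal L c k b := by
  induction ha with
  | empty a => intro b _; exact .empty b
  | cond1 k a hk ha hkL heq =>
    intro b hb
    exact .cond1 k b hk (hb 1 le_rfl hk ▸ ha) hkL fun i h1 h2 => by rw [← hb i h1 h2, heq i h1 h2]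
  | cond2 k a s l ha hs hsL hk heq hlt hzero hrest ih =>
    intro b hb
    refine .cond2 k b s l (hb 1 le_rfl (by omega) ▸ ha) hs hsL hk
      (fun i h1 h2 => by rw [← hb i h1 (by omega), heq i h1 h2])
      (by rw [← hb s hs (by omega)]; exact hlt)
      (fun i h1 h2 => by rw [← hb i (by omega) (by omega), hzero i h1 h2])
      (ih fun i h1 h2 => hb _ (by omega) (by omega))

theorem IsLegal.first_pos {L : ℕ} {c : ℕ → ℕ} {k : ℕ} {a : ℕ → ℕ} (ha : IsLegal L c k a)
    (hk : 1 ≤ k) : 0 < a 1 := by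
  cases ha with
  | empty => omega
  | cond1 => assumption
  | cond2 => assumption

theorem IsLegal.le_digitValue {L : ℕ} {c : ℕ → ℕ} (G : ℕ → ℕ) {k : ℕ} {a : ℕ → ℕ}
    (ha : IsLegal L c k a) (hk : 1 ≤ k) : G k ≤ digitValue G k a := by
  unfold digitValue
  calc G k ≤ a (0 + 1) * G (k - 0) := by
        simpa using Nat.le_mul_of_pos_left (G k) (ha.first_pos hk)
    _ ≤ _ := single_le_sum (f := fun i => a (i + 1) * G (k - i)) (fun _ _ => Nat.zero_le _)
        (mem_range.2 hk)

namespace IsMonotonePLRS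

variable {L : ℕ} {c G : ℕ → ℕ}

/-- Induction along legality: the bound on the value of the remaining digits places them in the
cylinder of the first block, where the count is additive. Hence all legal decompositions of a number
have the same digit sum. -/
theorem greedyCount_digitValue (h : IsMonotonePLRS L c G) {k : ℕ} {a : ℕ → ℕ}
    (ha : IsLegal L c k a) : digitValue G k a < G (k + 1) ∧
      greedyCount G (digitValue G k a) = ∑ i ∈ range k, a (i + 1) := by
  induction ha with
  | empty a => simp [digitValue, h.one, greedyCount_zero]
  | cond1 k a hk ha hkL heq =>
    have hp := h.greedyCount_prefix k k 0 0 (by omega) (Or.inr ⟨rfl, rfl, hkL⟩)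
    have e1 : digitValue G k a = ∑ i ∈ range k, c (i + 1) * G (k - i) :=
      sum_congr rfl fun i hi => by rw [heq _ (by omega) (mem_range.1 hi)]
    have e2 : ∑ i ∈ range k, a (i + 1) = ∑ i ∈ range k, c (i + 1) :=
      sum_congr rfl fun i hi => by rw [heq _ (by omega) (mem_range.1 hi)]
    simpa [e1, e2, greedyCount_zero] using hp
  | cond2 k a s l ha hs hsL hk heq hlt hzero hrest ih =>
    obtain ⟨n, rfl⟩ : ∃ n, s = n + 1 := ⟨s - 1, by omega⟩
    obtain ⟨m, rfl⟩ : ∃ m, k = n + 1 + l + m := ⟨k - (n + 1 + l), by omega⟩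
    have em : n + 1 + l + m - (n + 1) - l = m := by omega
    rw [em] at ih
    have ht : digitValue G m (fun i => a (n + 1 + l + i)) < G (n + 1 + l + m - n) :=
      ih.1.trans_le (h.le_of_le (by omega) (by omega))
    have hc := h.greedyCount_cylinder (k := n + 1 + l + m) hsL (by omega) hlt ht
    rw [digitValue_split heq hzero, digitSum_split heq hzero, hc.2, ih.2]
    exact ⟨hc.1, rfl⟩

theorem exists_index (h : IsMonotonePLRS L c G) {N : ℕ} (hN : 1 ≤ N) :
    ∃ k, 1 ≤ k ∧ G k ≤ N ∧ N < G (k + 1) := by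
  have h0 : ∃ k, N < G (k + 1) := ⟨N, h.self_le (a := N + 1) (by omega)⟩
  classical
  refine ⟨Nat.find h0, ?_, ?_, Nat.find_spec h0⟩
  · by_contra hc
    have h1 := Nat.find_spec h0
    rw [show Nat.find h0 = 0 by omega, h.one] at h1
    omega
  · by_contra hc
    have hpos : Nat.find h0 ≠ 0 := by
      intro h1
      have h2 := Nat.find_spec h0
      rw [h1, h.one] at h2
      omega
    refine Nat.find_min h0 (m := Nat.find h0 - 1) (by omega) ?_
    rw [Nat.sub_add_cancel (by omega)]
    omega

/-- Take the longest prefix of `c` whose value is at most `N`. If it uses up all `k < L` positions,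
then it equals `N`; it cannot have length `L`, since `N < G (k + 1)`. Otherwise division of the
remainder by `G (k - n)` gives a digit below `c (n + 1)` and a smaller number to decompose. -/
theorem exists_legal (h : IsMonotonePLRS L c G) (N : ℕ) :
    ∃ k a, IsLegal L c k a ∧ digitValue G k a = N := by
  induction N using Nat.strong_induction_on with
  | _ N ih =>
  rcases Nat.eq_zero_or_pos N with rfl | hN
  · exact ⟨0, fun _ => 0, .empty _, by simp [digitValue]⟩
  obtain ⟨k, hk, h1, h2⟩ := h.exists_index hN
  set P : ℕ → Prop := fun n => ∑ i ∈ range n, c (i + 1) * G (k - i) ≤ N with hP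
  classical
  obtain ⟨n, hn⟩ : ∃ n, n = Nat.findGreatest P (min k L) := ⟨_, rfl⟩
  have hnle : n ≤ min k L := hn ▸ Nat.findGreatest_le _
  have hPn : P n := hn ▸ Nat.findGreatest_spec (m := 0) (Nat.zero_le _) (by simp [hP])
  rcases hnle.eq_or_lt with heq | hlt
  · rcases lt_or_ge k L with hkL | hkL
    · have : n = k := by omega
      subst this
      refine ⟨n, c, .cond1 n c hk h.first_coeff_pos hkL fun _ _ _ => rfl, ?_⟩
      rw [h.initial_range hkL] at h2
      exact le_antisymm hPn (Nat.lt_succ_iff.1 h2)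
    · have : n = L := by omega
      subst this
      rw [h.recurrence_range hkL] at h2
      exact absurd h2 (not_lt.2 hPn)
  · have hPn' : ¬ P (n + 1) := by
      intro hc
      have := Nat.le_findGreatest (m := n + 1) (n := min k L) (by omega) hc
      omega
    simp only [hP, sum_range_succ, not_le] at hPn' hPn
    obtain ⟨R, hR⟩ := Nat.exists_eq_add_of_le hPn
    have hR' : R < c (n + 1) * G (k - n) := by omega
    have hgpos : 0 < G (k - n) := h.pos _ (by omega)
    have hmod := Nat.mod_lt R hgpos
    obtain ⟨k', a', hleg, hval⟩ := ih (R % G (k - n))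
      (hmod.trans_le ((h.le_of_le (by omega) (Nat.sub_le k n)).trans h1))
    -- The remainder is below `G (k - n)`, so its decomposition is short enough to fit; the gap is
    -- filled by `l` zeros.
    have hk' : k' ≤ k - n - 1 := by
      by_contra hc
      have h3 := hleg.le_digitValue G (by omega)
      have h4 := h.le_of_le (show 1 ≤ k - n by omega) (show k - n ≤ k' by omega)
      omega
    obtain ⟨l, rfl⟩ : ∃ l, k = n + 1 + l + k' := ⟨k - (n + 1 + k'), by omega⟩
    set g := G (n + 1 + l + k' - n) with hg
    let a : ℕ → ℕ := fun i => if i < n + 1 then c i else if i = n + 1 then R / g else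
      if i ≤ n + 1 + l then 0 else a' (i - (n + 1 + l))
    have ha1 : ∀ i, 1 ≤ i → i < n + 1 → a i = c i := fun i _ hi => if_pos hi
    have ha2 : a (n + 1) = R / g := by simp [a]
    have ha3 : ∀ i, n + 1 < i → i ≤ n + 1 + l → a i = 0 := fun i h3 h4 => by
      simp only [a, if_neg (show ¬ i < n + 1 by omega), if_neg (show ¬ i = n + 1 by omega),
        if_pos h4]
    have ha4 : ∀ i, 1 ≤ i → i ≤ k' → a' i = a (n + 1 + l + i) := fun i h3 h4 => by
      simp only [a, if_neg (show ¬ n + 1 + l + i < n + 1 by omega),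
        if_neg (show ¬ n + 1 + l + i = n + 1 by omega),
        if_neg (show ¬ n + 1 + l + i ≤ n + 1 + l by omega), Nat.add_sub_cancel_left]
    have ha5 : digitValue G k' (fun i => a (n + 1 + l + i)) = digitValue G k' a' :=
      sum_congr rfl fun i hi => by rw [ha4 (i + 1) (by omega) (mem_range.1 hi)]
    refine ⟨n + 1 + l + k', a, .cond2 _ a (n + 1) l ?_ (by omega) (by omega) (by omega) ha1 ?_ ha3
      ?_, ?_⟩
    · rcases Nat.eq_zero_or_pos n with rfl | hn0
      · rw [show (1 : ℕ) = 0 + 1 from rfl, ha2]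
        refine Nat.div_pos ?_ hgpos
        simp only [range_zero, sum_empty, Nat.zero_add] at hR
        rw [← hR, hg, Nat.sub_zero]
        exact h1
      · rw [ha1 1 le_rfl (by omega)]
        exact h.first_coeff_pos
    · rw [ha2]
      exact Nat.div_lt_of_lt_mul (by rwa [Nat.mul_comm])
    · rw [show n + 1 + l + k' - (n + 1) - l = k' by omega]
      exact hleg.congr ha4
    · rw [digitValue_split ha1 ha3, ha5, hval, ha2, hR, Nat.mul_comm (R / g), Nat.div_add_mod]

/-- The set of possible digit sums is a singleton, so the infimum in `numSummands` makes no choice.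
-/
theorem numSummands_eq (h : IsMonotonePLRS L c G) (N : ℕ) :
    numSummands L c G N = greedyCount G N := by
  have : {r | IsNumSummands L c G N r} = {greedyCount G N} := by
    ext r
    have e : ∀ k a, ∑ i ∈ Icc 1 k, a i * G (k + 1 - i) = digitValue G k a := by
      intro k a
      rw [sum_Icc_one_eq_sum_range]
      simp [digitValue]
    simp only [IsNumSummands, e, sum_Icc_one_eq_sum_range, Set.mem_ofPred_eq,
      Set.mem_singleton_iff]
    constructor
    · rintro ⟨k, a, ha, rfl, rfl⟩
      exact (h.greedyCount_digitValue ha).2.symm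
    · rintro rfl
      obtain ⟨k, a, ha, rfl⟩ := h.exists_legal N
      exact ⟨k, a, ha, rfl, (h.greedyCount_digitValue ha).2⟩
  rw [numSummands, this, csInf_singleton]

/-- Summation over `[0, G (k + 1))` along the cylinders of the first block. -/
theorem sum_range_succ_cylinder {M : Type*} [AddCommMonoid M] (h : IsMonotonePLRS L c G) {k : ℕ}
    (hk : L ≤ k) (f : ℕ → M) :
    ∑ x ∈ range (G (k + 1)), f x = ∑ n ∈ range L, ∑ j ∈ range (c (n + 1)),
      ∑ t ∈ range (G (k - n)), f (∑ i ∈ range n, c (i + 1) * G (k - i) + (j * G (k - n) + t)) := by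
  rw [h.recurrence_range hk]
  have hmul : ∀ (a b : ℕ) (f : ℕ → M), ∑ x ∈ range (a * b), f x =
      ∑ j ∈ range a, ∑ t ∈ range b, f (j * b + t) := by
    intro a b f
    induction a with
    | zero => simp
    | succ a ih => rw [Nat.succ_mul, sum_range_add, ih, sum_range_succ]
  generalize L = n
  induction n with
  | zero => simp
  | succ n ih => rw [sum_range_succ, sum_range_add, ih, sum_range_succ, hmul]

end IsMonotonePLRS

/-! ### The perturbed renewal equation -/

theorem perturbed_contraction_bound {x : ℕ → ℂ} {Y : ℕ → ℝ} {δ ε η : ℝ} {N : ℕ} (hδ : 0 < δ)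
    (hY : ∀ k, 0 ≤ Y k) (hε : 0 ≤ ε) (hη : 0 ≤ η)
    (hYs : ∀ k, Y (k + 1) ≤ (1 - δ + ε) * Y k + η * ‖x k‖)
    (hx : ∀ k, ‖x (k + 1) - x k‖ ≤ η * ‖x k‖ + ε * Y k) (hεδ : ε ≤ δ / 4) (hδ1 : δ ≤ 1)
    (hN : N * η ≤ 1) :
    ‖x N - x 0‖ ≤ ε * (2 / δ) * Y 0 + N * η * (2 * (Real.exp 2 * (‖x 0‖ + Y 0))) ∧
      Y N ≤ (1 - δ / 2) ^ N * Y 0 + η * (Real.exp 2 * (‖x 0‖ + Y 0)) * (2 / δ) := by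
  -- A crude a priori bound: since `N * η ≤ 1`, the total size grows at most by the factor `exp 2`
  -- in `N` steps.
  have hT : ∀ k, ‖x k‖ + Y k ≤ (1 + 2 * η) ^ k * (‖x 0‖ + Y 0) := by
    intro k
    induction k with
    | zero => simp
    | succ k ih =>
      have h1 : ‖x (k + 1)‖ ≤ ‖x k‖ + ‖x (k + 1) - x k‖ := by
        simpa using norm_add_le (x k) (x (k + 1) - x k)
      calc ‖x (k + 1)‖ + Y (k + 1) ≤ (1 + 2 * η) * (‖x k‖ + Y k) := by
            nlinarith [hx k, hYs k, hY k, norm_nonneg (x k), mul_nonneg hη (hY k),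
              mul_nonneg (sub_nonneg.2 hεδ) (hY k), mul_nonneg hδ.le (hY k)]
        _ ≤ (1 + 2 * η) * ((1 + 2 * η) ^ k * (‖x 0‖ + Y 0)) := by gcongr
        _ = _ := by ring
  set M := Real.exp 2 * (‖x 0‖ + Y 0) with hM
  have hT0 : 0 ≤ ‖x 0‖ + Y 0 := add_nonneg (norm_nonneg _) (hY 0)
  have hM0 : 0 ≤ M := by positivity
  have hxM : ∀ k ≤ N, ‖x k‖ ≤ M := by
    intro k hk
    have h1 : (1 + 2 * η) ^ k ≤ Real.exp 2 := by
      calc (1 + 2 * η) ^ k ≤ (Real.exp (2 * η)) ^ k := by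
            gcongr
            linarith [Real.add_one_le_exp (2 * η)]
        _ = Real.exp (k * (2 * η)) := (Real.exp_nat_mul _ _).symm
        _ ≤ Real.exp 2 := by
            apply Real.exp_le_exp.2
            have : (k : ℝ) * η ≤ N * η := by gcongr
            linarith
    calc ‖x k‖ ≤ ‖x k‖ + Y k := by linarith [hY k]
      _ ≤ _ := hT k
      _ ≤ M := by rw [hM]; gcongr
  constructor
  -- A Lyapunov function: the term `ε * (2 / δ) * Y k` loses at least `ε * Y k` per step, up to a
  -- multiple of `η`, which pays for the drift of `x`.
  · have key : ∀ k ≤ N, ‖x k - x 0‖ + ε * (2 / δ) * Y k ≤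
        ε * (2 / δ) * Y 0 + k * η * (2 * M) := by
      intro k
      induction k with
      | zero => simp
      | succ k ih =>
        intro hk
        have ih' := ih (by omega)
        have h1 : ‖x (k + 1) - x 0‖ ≤ ‖x (k + 1) - x k‖ + ‖x k - x 0‖ := by
          simpa using norm_add_le (x (k + 1) - x k) (x k - x 0)
        have h2 : η * ‖x k‖ ≤ η * M := by gcongr; exact hxM k (by omega)
        have h3 : ε * (2 / δ) * Y (k + 1) ≤ ε * (2 / δ) * ((1 - δ / 2) * Y k + η * M) := by
          gcongr
          nlinarith [hYs k, hY k]
        have h4 : ε * (2 / δ) * ((1 - δ / 2) * Y k + η * M) =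
            ε * (2 / δ) * Y k - ε * Y k + ε * (2 / δ) * (η * M) := by
          field_simp
        have h5 : ε * (2 / δ) ≤ 1 := by
          rw [mul_div_assoc', div_le_one hδ]; linarith
        have h6 : ε * (2 / δ) * (η * M) ≤ 1 * (η * M) := by gcongr
        push_cast
        nlinarith [hx k]
    have := key N le_rfl
    have h0 : 0 ≤ ε * (2 / δ) * Y N := by have := hY N; positivity
    linarith
  · have key : ∀ k ≤ N, Y k ≤ (1 - δ / 2) ^ k * Y 0 + η * M * (2 / δ) := by
      intro k
      induction k with
      | zero => intro _; simp only [pow_zero, one_mul]; have : 0 ≤ η * M * (2 / δ) := by positivity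
                linarith
      | succ k ih =>
        intro hk
        have h2 : η * ‖x k‖ ≤ η * M := by gcongr; exact hxM k (by omega)
        have h3 : Y (k + 1) ≤ (1 - δ / 2) * Y k + η * M := by nlinarith [hYs k, hY k]
        have h4 : (1 - δ / 2) * Y k ≤
            (1 - δ / 2) * ((1 - δ / 2) ^ k * Y 0 + η * M * (2 / δ)) := by
          gcongr
          · linarith
          · exact ih (by omega)
        have h5 : (1 - δ / 2) * ((1 - δ / 2) ^ k * Y 0 + η * M * (2 / δ)) + η * M =
            (1 - δ / 2) ^ (k + 1) * Y 0 + η * M * (2 / δ) := by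
          field_simp
          ring
        linarith
    exact key N le_rfl

/-- The deviation `Y` decays geometrically up to `O(η)`, so the coupling need only satisfy `ε → 0`,
not `N ε → 0`. This matters because in the application `ε` is only known to be of order `N^(-1/2)`.
-/
theorem tendsto_perturbed_contraction {ι : Type*} {l : Filter ι} {x : ι → ℕ → ℂ} {Y : ι → ℕ → ℝ}
    {δ B : ℝ} {ε η : ι → ℝ} {N : ι → ℕ} {x₀ : ℂ} (hδ : 0 < δ) (hδ1 : δ ≤ 1)
    (hY : ∀ i k, 0 ≤ Y i k) (hε : ∀ i, 0 ≤ ε i) (hη : ∀ i, 0 ≤ η i)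
    (hYs : ∀ i k, Y i (k + 1) ≤ (1 - δ + ε i) * Y i k + η i * ‖x i k‖)
    (hx : ∀ i k, ‖x i (k + 1) - x i k‖ ≤ η i * ‖x i k‖ + ε i * Y i k)
    (hε0 : Tendsto ε l (𝓝 0)) (hη0 : Tendsto (fun i => N i * η i) l (𝓝 0))
    (hN : Tendsto N l atTop) (hx0 : Tendsto (fun i => x i 0) l (𝓝 x₀))
    (hB : ∀ᶠ i in l, Y i 0 ≤ B) :
    Tendsto (fun i => x i (N i)) l (𝓝 x₀) ∧ Tendsto (fun i => Y i (N i)) l (𝓝 0) := by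
  have hη1 : Tendsto η l (𝓝 0) := by
    refine squeeze_zero' (.of_forall hη) ?_ hη0
    filter_upwards [hN.eventually_ge_atTop 1] with i hi
    have : (1 : ℝ) ≤ N i := by exact_mod_cast hi
    nlinarith [hη i]
  have hb : ∀ᶠ i in l, ‖x i 0‖ ≤ ‖x₀‖ + 1 :=
    (hx0.norm.eventually (ge_mem_nhds (by linarith)))
  have hmain : ∀ᶠ i in l,
      ‖x i (N i) - x i 0‖ ≤ ε i * (2 / δ) * B +
        N i * η i * (2 * (Real.exp 2 * (‖x₀‖ + 1 + B))) ∧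
      Y i (N i) ≤ (1 - δ / 2) ^ (N i) * B + η i * (Real.exp 2 * (‖x₀‖ + 1 + B)) * (2 / δ) := by
    filter_upwards [hb, hB, hε0.eventually (ge_mem_nhds (show 0 < δ / 4 by linarith)),
      hη0.eventually (ge_mem_nhds (show (0 : ℝ) < 1 by norm_num))] with i h1 h2 h3 h4
    obtain ⟨h5, h6⟩ := perturbed_contraction_bound hδ (hY i) (hε i) (hη i) (hYs i) (hx i) h3 hδ1 h4
    have := hε i
    have := hη i
    have h7 : 0 ≤ 1 - δ / 2 := by linarith
    constructor
    · refine h5.trans ?_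
      gcongr
    · refine h6.trans ?_
      gcongr
  constructor
  · have h1 : Tendsto (fun i => x i (N i) - x i 0) l (𝓝 0) := by
      refine squeeze_zero_norm' (hmain.mono fun i hi => hi.1) ?_
      simpa using ((hε0.mul_const (2 / δ)).mul_const B).add
        (hη0.mul_const (2 * (Real.exp 2 * (‖x₀‖ + 1 + B))))
    simpa using h1.add hx0
  · refine squeeze_zero' (.of_forall fun i => hY i _) (hmain.mono fun i hi => hi.2) ?_
    have h2 : Tendsto (fun i => (1 - δ / 2) ^ (N i)) l (𝓝 0) :=
      (tendsto_pow_atTop_nhds_zero_of_lt_one (by linarith) (by linarith)).comp hN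
    simpa using (h2.mul_const B).add
      ((hη1.mul_const (Real.exp 2 * (‖x₀‖ + 1 + B))).mul_const (2 / δ))

/-- The tail sums `p j + ⋯ + p (L - 1)`. -/
def tailSum (L : ℕ) (p : ℕ → ℝ) (j : ℕ) : ℝ := ∑ i ∈ Ico j L, p i

/-- The limit of the solution of the renewal equation with weights `p 0, …, p (L - 1)` and initial
values `h 0, …, h (L - 1)`. -/
noncomputable def renewalMean (L : ℕ) (p : ℕ → ℝ) (v : ℕ → ℂ) : ℂ :=
  (∑ j ∈ range L, tailSum L p j • v j) / ((∑ j ∈ range L, tailSum L p j : ℝ) : ℂ)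

/-- The window `v` moved by one step, with new entry `z`. -/
def shiftWindow (v : ℕ → ℂ) (z : ℂ) : ℕ → ℂ
  | 0 => z
  | j + 1 => v j

/-- The embedding of windows of length `L` into Euclidean space for which one step of the renewal
equation is a contraction. -/
noncomputable def windowEmb (L : ℕ) (p : ℕ → ℝ) : (ℕ → ℂ) →ₗ[ℂ] EuclideanSpace ℂ (Fin L) where
  toFun v := WithLp.toLp 2 fun j : Fin L => (√(tailSum L p j) : ℂ) * v j
  map_add' v w := by ext j; simp [mul_add]
  map_smul' a v := by ext j; simp [mul_left_comm]

section Window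

variable {L : ℕ} {p : ℕ → ℝ} {δ : ℝ}

theorem tailSum_zero (hsum : ∑ i ∈ range L, p i = 1) : tailSum L p 0 = 1 := by
  rw [tailSum, ← Finset.range_eq_Ico, hsum]

theorem tailSum_eq {j : ℕ} (hj : j < L) : tailSum L p j = p j + tailSum L p (j + 1) :=
  Finset.sum_eq_sum_Ico_succ_bot hj p

theorem tailSum_self : tailSum L p L = 0 := by simp [tailSum]

theorem le_tailSum (hδ : 0 < δ) (hp : ∀ i < L, δ ≤ p i) {j : ℕ} (hj : j < L) :
    δ ≤ tailSum L p j := by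
  rw [tailSum_eq hj]
  have : 0 ≤ tailSum L p (j + 1) := sum_nonneg fun i hi => by
    have := hp i (mem_Ico.1 hi).2
    linarith
  linarith [hp j hj]

theorem tailSum_le_one (hδ : 0 < δ) (hp : ∀ i < L, δ ≤ p i) (hsum : ∑ i ∈ range L, p i = 1)
    (j : ℕ) : tailSum L p j ≤ 1 := by
  rw [← hsum, Finset.range_eq_Ico]
  refine sum_le_sum_of_subset_of_nonneg (Ico_subset_Ico_left (Nat.zero_le _)) fun i hi _ => ?_
  have := hp i (mem_Ico.1 hi).2
  linarith

/-- Summation by parts. With `f` the shifted window it shows that a renewal step conserves the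
tail-weighted mean; with `f` its squared norms it measures the loss of energy. -/
theorem sum_tailSum_shift {M : Type*} [AddCommGroup M] [Module ℝ M]
    (hsum : ∑ i ∈ range L, p i = 1) (f : ℕ → M) :
    ∑ j ∈ range L, tailSum L p j • f j =
      f 0 + ∑ j ∈ range L, tailSum L p j • f (j + 1) - ∑ j ∈ range L, p j • f (j + 1) := by
  have h1 : ∑ j ∈ range L, tailSum L p j • f (j + 1) - ∑ j ∈ range L, p j • f (j + 1) =
      ∑ j ∈ range L, tailSum L p (j + 1) • f (j + 1) := by
    rw [← sum_sub_distrib]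
    refine sum_congr rfl fun j hj => ?_
    rw [tailSum_eq (mem_range.1 hj), add_smul, add_sub_cancel_left]
  rw [add_sub_assoc, h1]
  have h2 := sum_range_succ' (fun j => tailSum L p j • f j) L
  rw [sum_range_succ, tailSum_self, zero_smul, add_zero, tailSum_zero hsum, one_smul] at h2
  rw [h2, add_comm]

theorem norm_windowEmb_sq (hδ : 0 < δ) (hp : ∀ i < L, δ ≤ p i) (v : ℕ → ℂ) :
    ‖windowEmb L p v‖ ^ 2 = ∑ j ∈ range L, tailSum L p j * ‖v j‖ ^ 2 := by
  rw [EuclideanSpace.norm_sq_eq, Finset.sum_range]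
  refine sum_congr rfl fun j _ => ?_
  have h1 : 0 ≤ tailSum L p j := hδ.le.trans (le_tailSum hδ hp j.2)
  simp only [windowEmb, LinearMap.coe_mk, AddHom.coe_mk, norm_mul, mul_pow, Complex.norm_real,
    Real.norm_eq_abs, sq_abs, Real.sq_sqrt h1]

theorem norm_apply_le_windowEmb (hδ : 0 < δ) (hp : ∀ i < L, δ ≤ p i) (v : ℕ → ℂ) {j : ℕ}
    (hj : j < L) : ‖v j‖ ≤ ‖windowEmb L p v‖ / √δ := by
  rw [le_div_iff₀ (Real.sqrt_pos.2 hδ)]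
  refine le_of_sq_le_sq ?_ (norm_nonneg _)
  rw [mul_pow, Real.sq_sqrt hδ.le, norm_windowEmb_sq hδ hp]
  calc ‖v j‖ ^ 2 * δ ≤ tailSum L p j * ‖v j‖ ^ 2 := by
        rw [mul_comm]; gcongr; exact le_tailSum hδ hp hj
    _ ≤ _ := single_le_sum (f := fun j => tailSum L p j * ‖v j‖ ^ 2) (fun i hi =>
        mul_nonneg (hδ.le.trans (le_tailSum hδ hp (mem_range.1 hi))) (sq_nonneg _))
        (mem_range.2 hj)

theorem sum_mul_norm_sub_sq (w : ℕ → ℝ) (v : ℕ → ℂ) (z : ℂ) :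
    ∑ j ∈ range L, w j * ‖v j - z‖ ^ 2 = ∑ j ∈ range L, w j * ‖v j‖ ^ 2 -
      2 * (inner ℝ (∑ j ∈ range L, w j • v j) z) + (∑ j ∈ range L, w j) * ‖z‖ ^ 2 := by
  rw [sum_inner, mul_sum, sum_mul, ← sum_sub_distrib, ← sum_add_distrib]
  refine sum_congr rfl fun j _ => ?_
  rw [norm_sub_sq_real, real_inner_smul_left]
  ring

/-- With `z` the new entry, the squared norm drops by the variance `∑ p j ‖v j - z‖²`. As `p j ≥ δ ≥
δ * tailSum L p j`, this is at least `δ ∑ tailSum L p j ‖v j - z‖²`, and since `v` has tail-weighted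
mean zero, that is at least `δ` times the squared norm of `v`. -/
theorem norm_windowEmb_shift_le (hδ : 0 < δ) (hδ1 : δ ≤ 1) (hp : ∀ i < L, δ ≤ p i)
    (hsum : ∑ i ∈ range L, p i = 1) {v : ℕ → ℂ} (hv : ∑ j ∈ range L, tailSum L p j • v j = 0) :
    ‖windowEmb L p (shiftWindow v (∑ j ∈ range L, p j • v j))‖ ≤
      √(1 - δ) * ‖windowEmb L p v‖ := by
  refine le_of_sq_le_sq ?_ (by positivity)
  rw [mul_pow, Real.sq_sqrt (by linarith), norm_windowEmb_sq hδ hp, norm_windowEmb_sq hδ hp]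
  set z := ∑ j ∈ range L, p j • v j with hz
  have h1 : ∑ j ∈ range L, tailSum L p j * ‖shiftWindow v z j‖ ^ 2 =
      ‖z‖ ^ 2 + ∑ j ∈ range L, tailSum L p j * ‖v j‖ ^ 2 - ∑ j ∈ range L, p j * ‖v j‖ ^ 2 :=
    sum_tailSum_shift hsum (fun j => ‖shiftWindow v z j‖ ^ 2)
  have h2 := sum_mul_norm_sub_sq (L := L) p v z
  have h3 := sum_mul_norm_sub_sq (L := L) (tailSum L p) v z
  rw [← hz, hsum, real_inner_self_eq_norm_sq] at h2
  rw [hv, inner_zero_left] at h3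
  have h4 : δ * ∑ j ∈ range L, tailSum L p j * ‖v j - z‖ ^ 2 ≤
      ∑ j ∈ range L, p j * ‖v j - z‖ ^ 2 := by
    rw [mul_sum]
    refine sum_le_sum fun j hj => ?_
    have := tailSum_le_one hδ hp hsum j
    have := hp j (mem_range.1 hj)
    have hs : 0 ≤ ‖v j - z‖ ^ 2 := sq_nonneg _
    rw [← mul_assoc]
    refine mul_le_mul_of_nonneg_right ?_ hs
    nlinarith
  have h5 : 0 ≤ (∑ j ∈ range L, tailSum L p j) * ‖z‖ ^ 2 :=
    mul_nonneg (sum_nonneg fun j hj => hδ.le.trans (le_tailSum hδ hp (mem_range.1 hj)))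
      (sq_nonneg _)
  nlinarith

theorem one_le_sum_tailSum (hL : 0 < L) (hδ : 0 < δ) (hp : ∀ i < L, δ ≤ p i)
    (hsum : ∑ i ∈ range L, p i = 1) : 1 ≤ ∑ j ∈ range L, tailSum L p j := by
  rw [← tailSum_zero hsum]
  exact single_le_sum (fun j hj => hδ.le.trans (le_tailSum hδ hp (mem_range.1 hj)))
    (mem_range.2 hL)

theorem renewalMean_shift (hsum : ∑ i ∈ range L, p i = 1) (v : ℕ → ℂ) (z : ℂ) :
    renewalMean L p (shiftWindow v z) = renewalMean L p v +
      (z - ∑ j ∈ range L, p j • v j) / ((∑ j ∈ range L, tailSum L p j : ℝ) : ℂ) := by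
  rw [renewalMean, renewalMean, sum_tailSum_shift hsum, ← add_div]
  simp only [shiftWindow]
  congr 1
  ring

/-- One step of the perturbed renewal equation, in terms of the mean and the deviation of the
window. -/
theorem perturbed_renewal_step (hL : 0 < L) (hδ : 0 < δ) (hδ1 : δ ≤ 1) (hp : ∀ i < L, δ ≤ p i)
    (hsum : ∑ i ∈ range L, p i = 1) : ∃ K : ℝ, 1 ≤ K ∧ ∀ (q v : ℕ → ℂ),
    ‖renewalMean L p (shiftWindow v (∑ j ∈ range L, q j * v j)) - renewalMean L p v‖ ≤
      K * ‖∑ j ∈ range L, q j - 1‖ * ‖renewalMean L p v‖ +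
      K * ((∑ j ∈ range L, ‖q j - p j‖) / √δ) *
        ‖windowEmb L p (fun j => v j - renewalMean L p v)‖ ∧
    ‖windowEmb L p (fun j => shiftWindow v (∑ j ∈ range L, q j * v j) j -
        renewalMean L p (shiftWindow v (∑ j ∈ range L, q j * v j)))‖ ≤
      (√(1 - δ) + K * ((∑ j ∈ range L, ‖q j - p j‖) / √δ)) *
        ‖windowEmb L p (fun j => v j - renewalMean L p v)‖ +
      K * ‖∑ j ∈ range L, q j - 1‖ * ‖renewalMean L p v‖ := by
  set S := ∑ j ∈ range L, tailSum L p j with hS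
  have hS1 : 1 ≤ S := one_le_sum_tailSum hL hδ hp hsum
  have hS0 : (S : ℂ) ≠ 0 := by
    have : S ≠ 0 := by linarith
    exact_mod_cast this
  -- The unit window at the newest entry minus its mean `1 / S`: an error `w` in the new entry adds
  -- `w • u` to the deviation.
  set u : ℕ → ℂ := fun j => shiftWindow 0 1 j - 1 / (S : ℂ) with hu
  refine ⟨max 1 ‖windowEmb L p u‖, le_max_left _ _, fun q v => ?_⟩
  set K := max 1 ‖windowEmb L p u‖
  set x := renewalMean L p v with hx
  set y : ℕ → ℂ := fun j => v j - x with hy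
  set z := ∑ j ∈ range L, q j * v j with hz
  set w := z - ∑ j ∈ range L, p j • v j with hw
  have hsumC : ∑ j ∈ range L, (p j : ℂ) = 1 := by exact_mod_cast hsum
  have hv : ∀ j, v j = x + y j := fun j => by simp [hy]
  have hpv : ∑ j ∈ range L, p j • v j = x + ∑ j ∈ range L, p j • y j := by
    simp only [Complex.real_smul]
    simp only [hv, mul_add, sum_add_distrib, ← sum_mul, hsumC, one_mul]
  -- The mean feels only the defect of the total weight; the individual errors `q j - p j` act on
  -- the deviation alone.
  have hwe : w = (∑ j ∈ range L, q j - 1) * x + ∑ j ∈ range L, (q j - p j) * y j := by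
    rw [hw, hz, hpv]
    simp only [Complex.real_smul, sub_mul, sum_sub_distrib, hv, mul_add, sum_add_distrib,
      ← sum_mul, one_mul]
    ring
  have hwn : ‖w‖ ≤ ‖∑ j ∈ range L, q j - 1‖ * ‖x‖ +
      ((∑ j ∈ range L, ‖q j - p j‖) / √δ) * ‖windowEmb L p y‖ := by
    rw [hwe]
    refine (norm_add_le _ _).trans (add_le_add (norm_mul_le _ _) ?_)
    refine (norm_sum_le _ _).trans ?_
    rw [div_mul_eq_mul_div, mul_div_assoc, sum_mul]
    refine sum_le_sum fun j hj => (norm_mul_le _ _).trans ?_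
    gcongr
    exact norm_apply_le_windowEmb hδ hp y (mem_range.1 hj)
  have hy0 : ∑ j ∈ range L, tailSum L p j • y j = 0 := by
    have : ∑ j ∈ range L, tailSum L p j • y j =
        ∑ j ∈ range L, tailSum L p j • v j - (S : ℂ) * x := by
      rw [hS]
      push_cast
      simp only [hy, Complex.real_smul, mul_sub, sum_sub_distrib, sum_mul]
    rw [this, hx, renewalMean, ← hS, mul_div_cancel₀ _ hS0, sub_self]
  have hstep : renewalMean L p (shiftWindow v z) = x + w / S := renewalMean_shift hsum v z
  have hK1 : 1 ≤ K := le_max_left _ _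
  have hwK : K * ‖w‖ ≤ K * ‖∑ j ∈ range L, q j - 1‖ * ‖x‖ +
      K * ((∑ j ∈ range L, ‖q j - p j‖) / √δ) * ‖windowEmb L p y‖ := by
    calc K * ‖w‖ ≤ K * (‖∑ j ∈ range L, q j - 1‖ * ‖x‖ +
      ((∑ j ∈ range L, ‖q j - p j‖) / √δ) * ‖windowEmb L p y‖) := by gcongr
      _ = _ := by ring
  constructor
  · rw [hstep, add_sub_cancel_left]
    refine le_trans ?_ hwK
    rw [norm_div, Complex.norm_real, Real.norm_of_nonneg (by linarith)]
    calc ‖w‖ / S ≤ ‖w‖ := div_le_self (norm_nonneg _) hS1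
      _ ≤ K * ‖w‖ := le_mul_of_one_le_left (norm_nonneg _) hK1
  · have hdec : (fun j => shiftWindow v z j - renewalMean L p (shiftWindow v z)) =
        shiftWindow y (∑ j ∈ range L, p j • y j) + w • u := by
      funext j
      rw [hstep]
      cases j with
      | zero =>
        simp only [shiftWindow, hu, Pi.add_apply, Pi.smul_apply, smul_eq_mul]
        have : z = w + (x + ∑ j ∈ range L, p j • y j) := by rw [← hpv, hw]; ring
        rw [this]
        ring
      | succ j =>
        simp only [shiftWindow, hu, Pi.add_apply, Pi.smul_apply, smul_eq_mul, Pi.zero_apply, hy]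
        ring
    rw [hdec, map_add, map_smul]
    refine (norm_add_le _ _).trans ?_
    rw [norm_smul]
    have h1 := norm_windowEmb_shift_le hδ hδ1 hp hsum hy0
    have h2 : ‖w‖ * ‖windowEmb L p u‖ ≤ K * ‖w‖ := by
      rw [mul_comm]
      gcongr
      exact le_max_right _ _
    linarith

end Window

/-- Solutions of a perturbed renewal equation stay close to the limit of the unperturbed one. -/
theorem tendsto_perturbed_renewal {L : ℕ} (hL : 0 < L) {p : ℕ → ℝ} (hp : ∀ i < L, 0 < p i)
    (hsum : ∑ i ∈ range L, p i = 1) {ι : Type*} {l : Filter ι} {q h : ι → ℕ → ℂ} {N : ι → ℕ}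
    {h₀ : ℕ → ℂ} (hq : ∀ i < L, Tendsto (fun s => q s i) l (𝓝 (p i)))
    (hqs : Tendsto (fun s => (N s : ℝ) * ‖∑ i ∈ range L, q s i - 1‖) l (𝓝 0))
    (hN : Tendsto N l atTop)
    (hrec : ∀ s k, h s (k + L) = ∑ i ∈ range L, q s i * h s (k + L - 1 - i))
    (hh : ∀ j < L, Tendsto (fun s => h s j) l (𝓝 (h₀ j))) :
    Tendsto (fun s => h s (N s)) l (𝓝 (renewalMean L p fun j => h₀ (L - 1 - j))) := by
  obtain ⟨δ, hδ, hδ1, hδp⟩ : ∃ δ : ℝ, 0 < δ ∧ δ ≤ 1 ∧ ∀ i < L, δ ≤ p i := by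
    obtain ⟨i₀, hi₀, hmin⟩ := exists_min_image (range L) p ⟨0, mem_range.2 hL⟩
    refine ⟨p i₀, hp _ (mem_range.1 hi₀), ?_, fun i hi => hmin i (mem_range.2 hi)⟩
    rw [← hsum]
    exact single_le_sum (fun j hj => (hp j (mem_range.1 hj)).le) hi₀
  obtain ⟨K, hK1, hK⟩ := perturbed_renewal_step hL hδ hδ1 hδp hsum
  -- Windows list the newest value first, so `h s k` is the oldest entry, with index `L - 1`.
  set win : ι → ℕ → ℕ → ℂ := fun s k j => h s (k + L - 1 - j) with hwin
  set x : ι → ℕ → ℂ := fun s k => renewalMean L p (win s k) with hx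
  set Y : ι → ℕ → ℝ := fun s k => ‖windowEmb L p (fun j => win s k j - x s k)‖ with hY
  have hwcongr : ∀ v w : ℕ → ℂ, (∀ j < L, v j = w j) → windowEmb L p v = windowEmb L p w := by
    intro v w hvw
    ext j
    simp [windowEmb, hvw j j.2]
  have hmcongr : ∀ v w : ℕ → ℂ, (∀ j < L, v j = w j) → renewalMean L p v = renewalMean L p w := by
    intro v w hvw
    unfold renewalMean
    congr 1
    exact sum_congr rfl fun j hj => by rw [hvw j (mem_range.1 hj)]
  have hshift : ∀ s k, ∀ j < L, win s (k + 1) j =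
      shiftWindow (win s k) (∑ j ∈ range L, q s j * win s k j) j := by
    intro s k j hj
    cases j with
    | zero => simp only [hwin, shiftWindow]; rw [← hrec]; congr 1; omega
    | succ j => simp only [hwin, shiftWindow]; congr 1; omega
  have hx1 : ∀ s k, x s (k + 1) =
      renewalMean L p (shiftWindow (win s k) (∑ j ∈ range L, q s j * win s k j)) :=
    fun s k => hmcongr _ _ (hshift s k)
  have hY1 : ∀ s k, Y s (k + 1) = ‖windowEmb L p (fun j =>
      shiftWindow (win s k) (∑ j ∈ range L, q s j * win s k j) j -
      renewalMean L p (shiftWindow (win s k) (∑ j ∈ range L, q s j * win s k j)))‖ := by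
    intro s k
    simp only [hY]
    rw [← hx1]
    exact congrArg _ (hwcongr _ _ fun j hj => by rw [hshift s k j hj])
  have hsq : √(1 - δ) ≤ 1 - δ / 2 := by
    rw [Real.sqrt_le_left (by linarith)]
    nlinarith
  have hx0 : Tendsto (fun s => x s 0) l (𝓝 (renewalMean L p fun j => h₀ (L - 1 - j))) := by
    simp only [hx, renewalMean, hwin, Nat.zero_add]
    refine Tendsto.div_const (tendsto_finsetSum _ fun j hj => Tendsto.const_smul ?_ _) _
    exact hh _ (by omega)
  have hY0 : Tendsto (fun s => Y s 0) l (𝓝 ‖windowEmb L p (fun j =>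
      h₀ (L - 1 - j) - renewalMean L p fun j => h₀ (L - 1 - j))‖) := by
    refine Tendsto.norm ?_
    refine ((PiLp.continuous_toLp 2 (fun _ : Fin L => ℂ)).tendsto _).comp ?_
    refine tendsto_pi_nhds.2 fun j => Tendsto.const_mul _ (Tendsto.sub ?_ hx0)
    simp only [hwin, Nat.zero_add]
    exact hh _ (by omega)
  have hmain := tendsto_perturbed_contraction (l := l) (x := x) (Y := Y) (δ := δ / 2)
    (ε := fun s => K * ((∑ j ∈ range L, ‖q s j - p j‖) / √δ))
    (η := fun s => K * ‖∑ j ∈ range L, q s j - 1‖) (N := N) (half_pos hδ) (by linarith)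
    (fun s k => norm_nonneg _) (fun s => by positivity) (fun s => by positivity)
    (fun s k => by
      rw [hY1]
      refine ((hK (q s) (win s k)).2).trans ?_
      gcongr)
    (fun s k => by rw [hx1]; exact (hK (q s) (win s k)).1)
    (by
      have : Tendsto (fun s => ∑ j ∈ range L, ‖q s j - p j‖) l (𝓝 (∑ j ∈ range L, 0)) :=
        tendsto_finsetSum _ fun j hj => by
          simpa using ((hq j (mem_range.1 hj)).sub_const (p j : ℂ)).norm
      simpa using (this.div_const (√δ)).const_mul K)
    (by simpa [mul_left_comm] using hqs.const_mul K) hN hx0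
    (hY0.eventually (ge_mem_nhds (lt_add_one _)))
  have hdiff : Tendsto (fun s => h s (N s) - x s (N s)) l (𝓝 0) := by
    refine squeeze_zero_norm (fun s => ?_) (by simpa using hmain.2.div_const (√δ))
    have := norm_apply_le_windowEmb hδ hδp (fun j => win s (N s) j - x s (N s))
      (show L - 1 < L by omega)
    have e : win s (N s) (L - 1) = h s (N s) := by simp only [hwin]; congr 1; omega
    rw [e] at this
    exact this
  simpa using hdiff.add hmain.1

/-! ### Gaussian asymptotics on initial segments -/

theorem exp_sub_quadratic_isBigO (α β : ℂ) :
    (fun τ : ℂ => Complex.exp (τ * α + τ ^ 2 * β) - (1 + τ * α + τ ^ 2 * (β + α ^ 2 / 2)))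
      =O[𝓝 0] fun τ => τ ^ 3 := by
  have hz : Tendsto (fun τ : ℂ => τ * α + τ ^ 2 * β) (𝓝 0) (𝓝 0) := by
    have : Continuous fun τ : ℂ => τ * α + τ ^ 2 * β := by fun_prop
    simpa using this.tendsto 0
  have hzO : (fun τ : ℂ => τ * α + τ ^ 2 * β) =O[𝓝 0] fun τ => τ := by
    have : (fun τ : ℂ => τ * α + τ ^ 2 * β) = fun τ => τ * (α + τ * β) := by funext τ; ring
    rw [this]
    have hb : (fun τ : ℂ => α + τ * β) =O[𝓝 0] fun _ => (1 : ℂ) :=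
      ((by fun_prop : Continuous fun τ : ℂ => α + τ * β).tendsto 0).isBigO_one ℂ
    simpa using (isBigO_refl (fun τ : ℂ => τ) (𝓝 0)).mul hb
  have h1 := ((Complex.exp_sub_sum_range_isBigO_pow 3).comp_tendsto hz).trans (hzO.pow 3)
  have h2 : (fun τ : ℂ => τ ^ 3 * (α * β + τ * (β ^ 2 / 2))) =O[𝓝 0] fun τ => τ ^ 3 := by
    have hb : (fun τ : ℂ => α * β + τ * (β ^ 2 / 2)) =O[𝓝 0] fun _ => (1 : ℂ) :=
      ((by fun_prop : Continuous fun τ : ℂ => α * β + τ * (β ^ 2 / 2)).tendsto 0).isBigO_one ℂ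
    simpa using (isBigO_refl (fun τ : ℂ => τ ^ 3) (𝓝 0)).mul hb
  refine (h1.add h2).congr_left fun τ => ?_
  simp only [Function.comp, sum_range_succ, range_zero, sum_empty, Nat.factorial]
  push_cast
  ring

/-- The blocks `c 1, …, c n, j` with `n < L` and `j < c (n + 1)`. -/
def blocks (L : ℕ) (c : ℕ → ℕ) : Finset (Σ _ : ℕ, ℕ) :=
  (range L).sigma fun n => range (c (n + 1))

/-- The digit sum of a block. -/
def blockSum (c : ℕ → ℕ) (b : Σ _ : ℕ, ℕ) : ℕ := ∑ i ∈ range b.1, c (i + 1) + b.2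

/-- The sum of `exp (τ s(x))` over `x < G (k + 1)`. -/
noncomputable def expSum (G : ℕ → ℕ) (k : ℕ) (τ : ℂ) : ℂ :=
  ∑ x ∈ range (G (k + 1)), Complex.exp (τ * greedyCount G x)

/-- The three moment conditions cancel the Taylor coefficients of orders 0, 1 and 2. -/
theorem sum_exp_cube_isBigO {κ : Type*} (B : Finset κ) (w α β : κ → ℂ) (h0 : ∑ b ∈ B, w b = 1)
    (h1 : ∑ b ∈ B, w b * α b = 0) (h2 : ∑ b ∈ B, w b * (β b + α b ^ 2 / 2) = 0) :
    (fun τ : ℂ => ∑ b ∈ B, w b * Complex.exp (τ * α b + τ ^ 2 * β b) - 1)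
      =O[𝓝 0] fun τ => τ ^ 3 := by
  have h := IsBigO.fun_sum (s := B) fun b _ => (exp_sub_quadratic_isBigO (α b) (β b)).const_mul_left (w b)
  refine h.congr_left fun τ => ?_
  have e : ∀ b, w b * (Complex.exp (τ * α b + τ ^ 2 * β b) -
      (1 + τ * α b + τ ^ 2 * (β b + α b ^ 2 / 2))) =
      w b * Complex.exp (τ * α b + τ ^ 2 * β b) - (w b + τ * (w b * α b) +
        τ ^ 2 * (w b * (β b + α b ^ 2 / 2))) := fun b => by ring
  simp only [e, sum_sub_distrib, sum_add_distrib, ← mul_sum, h0, h1, h2]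
  ring

/-- If `τ √N` converges then so does `N τ ^ 2`, and `τ` tends to zero. -/
theorem tendsto_of_mul_sqrt {ι : Type*} {l : Filter ι} {N : ι → ℕ} {τ : ι → ℂ} {θ : ℂ}
    (hN : Tendsto N l atTop) (hτ : Tendsto (fun s => τ s * (√(N s) : ℝ)) l (𝓝 θ)) :
    Tendsto τ l (𝓝 0) ∧ Tendsto (fun s => (N s : ℂ) * τ s ^ 2) l (𝓝 (θ ^ 2)) := by
  constructor
  · have h1 : Tendsto (fun s => ((√(N s) : ℝ) : ℂ)⁻¹) l (𝓝 0) := by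
      have : Tendsto (fun s => (√(N s) : ℝ)⁻¹) l (𝓝 0) :=
        tendsto_inv_atTop_zero.comp (Real.tendsto_sqrt_atTop.comp
          (tendsto_natCast_atTop_atTop.comp hN))
      have := (Complex.continuous_ofReal.tendsto 0).comp this
      simpa [Function.comp_def] using this
    have h2 := hτ.mul h1
    rw [mul_zero] at h2
    refine h2.congr' ?_
    filter_upwards [hN.eventually_ge_atTop 1] with s hs
    have h3 : √(N s : ℝ) ≠ 0 := (Real.sqrt_pos.2 (by exact_mod_cast hs)).ne'
    have h4 : ((√(N s : ℝ) : ℝ) : ℂ) ≠ 0 := by exact_mod_cast h3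
    rw [mul_inv_cancel_right₀ h4]
  · refine (hτ.pow 2).congr fun s => ?_
    rw [mul_pow, ← Complex.ofReal_pow, Real.sq_sqrt (Nat.cast_nonneg _), mul_comm]
    simp

namespace IsMonotonePLRS

variable {L : ℕ} {c G : ℕ → ℕ}

theorem two_le_sum_coeff (h : IsMonotonePLRS L c G) : 2 ≤ ∑ i ∈ range L, c (i + 1) := by
  have h1 := h.lt_succ L h.length_pos
  rw [h.recurrence_range le_rfl] at h1
  have h2 : ∑ i ∈ range L, c (i + 1) * G (L - i) ≤ (∑ i ∈ range L, c (i + 1)) * G L := by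
    rw [sum_mul]
    refine sum_le_sum fun i hi => Nat.mul_le_mul_left _ (h.le_of_le ?_ (Nat.sub_le _ _))
    have := mem_range.1 hi
    omega
  by_contra hc
  have h3 : (∑ i ∈ range L, c (i + 1)) * G L ≤ 1 * G L := Nat.mul_le_mul_right _ (by omega)
  omega

/-- The polynomial is `0` at `0` and at least `2` at `1`. Its root turns `ρ ^ (length)` into a
probability distribution on the blocks. -/
theorem exists_root (h : IsMonotonePLRS L c G) :
    ∃ x : ℝ, 0 < x ∧ x < 1 ∧ ∑ i ∈ range L, (c (i + 1) : ℝ) * x ^ (i + 1) = 1 := by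
  have hcont : ContinuousOn (fun x : ℝ => ∑ i ∈ range L, (c (i + 1) : ℝ) * x ^ (i + 1))
      (Set.Icc 0 1) := by fun_prop
  have h2 : (2 : ℝ) ≤ ∑ i ∈ range L, (c (i + 1) : ℝ) := by exact_mod_cast h.two_le_sum_coeff
  have hmem : (1 : ℝ) ∈ Set.Ioo
      ((fun x : ℝ => ∑ i ∈ range L, (c (i + 1) : ℝ) * x ^ (i + 1)) 0)
      ((fun x : ℝ => ∑ i ∈ range L, (c (i + 1) : ℝ) * x ^ (i + 1)) 1) := by
    constructor
    · simp
    · simp only [one_pow, mul_one]; linarith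
  obtain ⟨x, hx, hx1⟩ := intermediate_value_Ioo (zero_le_one) hcont hmem
  exact ⟨x, hx.1, hx.2, hx1⟩

/-- Nondegeneracy of the variance. The block consisting of a single zero forces `μ = 0`, and some
block has positive digit sum: the digit `1` if `c 1 > 1`, otherwise `c 1, 0`. -/
theorem exists_blockSum_ne (h : IsMonotonePLRS L c G) (μ : ℝ) :
    ∃ b ∈ blocks L c, (blockSum c b : ℝ) - μ * (b.1 + 1) ≠ 0 := by
  by_contra hc
  push Not at hc
  have h0 := hc ⟨0, 0⟩ (by simp [blocks, h.length_pos, h.first_coeff_pos])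
  simp only [blockSum, range_zero, sum_empty] at h0
  have hμ : μ = 0 := by simpa using h0
  subst hμ
  rcases Nat.lt_or_ge 1 (c 1) with h1 | h1
  · have := hc ⟨0, 1⟩ (by simp [blocks, h.length_pos, h1])
    simp [blockSum] at this
  · have h2 := h.two_le_sum_coeff
    have hL : 1 < L := by
      by_contra hL
      have : L = 1 := by have := h.length_pos; omega
      subst this
      simp at h2
      omega
    have := hc ⟨1, 0⟩ (by simp [blocks, hL, h.coeff_pos (i := 2) (by norm_num) hL])
    simp only [blockSum, sum_range_one] at this
    have h3 := h.first_coeff_pos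
    simp at this
    omega

theorem expSum_rec (h : IsMonotonePLRS L c G) (k : ℕ) (τ : ℂ) :
    expSum G (k + L) τ = ∑ n ∈ range L, (∑ j ∈ range (c (n + 1)),
      Complex.exp (τ * blockSum c ⟨n, j⟩)) * expSum G (k + L - 1 - n) τ := by
  rw [expSum, h.sum_range_succ_cylinder (by omega)]
  refine sum_congr rfl fun n hn => ?_
  rw [sum_mul]
  refine sum_congr rfl fun j hj => ?_
  have hnL := mem_range.1 hn
  rw [expSum, mul_sum, show k + L - 1 - n + 1 = k + L - n by omega]
  refine sum_congr rfl fun t ht => ?_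
  rw [(h.greedyCount_cylinder hnL (by omega) (mem_range.1 hj) (mem_range.1 ht)).2,
    ← Complex.exp_add, blockSum]
  push_cast
  ring_nf

/-- The exponential sums over `[0, G (k + 1))` have Gaussian asymptotics. -/
theorem exists_quasiPower (h : IsMonotonePLRS L c G) :
    ∃ ρ μ σ U : ℝ, 0 < ρ ∧ ρ < 1 ∧ 0 < σ ∧ 0 < U ∧
      Tendsto (fun k : ℕ => ρ ^ k * (G (k + 1) : ℝ)) atTop (𝓝 U) ∧
      ∀ (ι : Type) (l : Filter ι) (N : ι → ℕ) (τ : ι → ℂ) (θ : ℂ), Tendsto N l atTop →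
        Tendsto (fun s => τ s * (√(N s) : ℝ)) l (𝓝 θ) →
        Tendsto (fun s => Complex.exp (-(τ s * μ * N s)) * expSum G (N s) (τ s) / G (N s + 1)) l
          (𝓝 (Complex.exp (σ ^ 2 * θ ^ 2 / 2))) := by
  obtain ⟨ρ, hρ0, hρ1, hroot⟩ := h.exists_root
  set p : ℕ → ℝ := fun i => (c (i + 1) : ℝ) * ρ ^ (i + 1) with hp
  have hppos : ∀ i < L, 0 < p i := fun i hi => by
    have : 0 < c (i + 1) := h.coeff_pos (by omega) (by omega)
    positivity
  have hblocks : ∀ f : ℕ → ℕ → ℝ, ∑ b ∈ blocks L c, f b.1 b.2 =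
      ∑ i ∈ range L, ∑ j ∈ range (c (i + 1)), f i j := fun f => sum_sigma _ _ _
  have hw1 : ∑ b ∈ blocks L c, ρ ^ (b.1 + 1) = 1 := by
    rw [hblocks fun i _ => ρ ^ (i + 1), ← hroot]
    simp [hp]
  obtain ⟨b₀, hb₀⟩ : (blocks L c).Nonempty := by
    obtain ⟨b, hb, -⟩ := h.exists_blockSum_ne 0
    exact ⟨b, hb⟩
  -- For a random block of law `ρ ^ (length)`: `m` is the mean length, `μ` the mean digit sum per
  -- position, and `v / m` the variance per position. The exponent `β` is chosen to cancel the
  -- second-order term.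
  set m := ∑ b ∈ blocks L c, ρ ^ (b.1 + 1) * ((b.1 : ℝ) + 1) with hm
  have hm0 : 0 < m := sum_pos (fun b _ => by positivity) ⟨b₀, hb₀⟩
  set μ := (∑ b ∈ blocks L c, ρ ^ (b.1 + 1) * blockSum c b) / m with hμ
  set α : (Σ _ : ℕ, ℕ) → ℝ := fun b => (blockSum c b : ℝ) - μ * (b.1 + 1) with hα
  set v := ∑ b ∈ blocks L c, ρ ^ (b.1 + 1) * α b ^ 2 with hv
  have hv0 : 0 < v := by
    obtain ⟨b, hb, hne⟩ := h.exists_blockSum_ne μ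
    refine sum_pos' (fun b _ => by positivity) ⟨b, hb, ?_⟩
    have : 0 < α b ^ 2 := by positivity
    positivity
  set σ := √(v / m) with hσ
  have hσ0 : 0 < σ := Real.sqrt_pos.2 (div_pos hv0 hm0)
  have hσ2 : σ ^ 2 = v / m := Real.sq_sqrt (div_pos hv0 hm0).le
  set β : (Σ _ : ℕ, ℕ) → ℝ := fun b => -(σ ^ 2 / 2 * (b.1 + 1)) with hβ
  have hm1 : ∑ b ∈ blocks L c, ρ ^ (b.1 + 1) * α b = 0 := by
    simp only [hα, mul_sub, sum_sub_distrib]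
    have : ∀ b : (Σ _ : ℕ, ℕ), ρ ^ (b.1 + 1) * (μ * ((b.1 : ℝ) + 1)) =
      μ * (ρ ^ (b.1 + 1) * ((b.1 : ℝ) + 1)) := fun b => by ring
    simp only [this, ← mul_sum]
    rw [← hm, hμ, div_mul_cancel₀ _ hm0.ne', sub_self]
  have hm2 : ∑ b ∈ blocks L c, ρ ^ (b.1 + 1) * (β b + α b ^ 2 / 2) = 0 := by
    have : ∀ b : (Σ _ : ℕ, ℕ), ρ ^ (b.1 + 1) * (β b + α b ^ 2 / 2) =
      -(σ ^ 2 / 2) * (ρ ^ (b.1 + 1) * ((b.1 : ℝ) + 1)) + (ρ ^ (b.1 + 1) * α b ^ 2) / 2 :=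
      fun b => by simp only [hβ]; ring
    simp only [this, sum_add_distrib, ← mul_sum, ← sum_div]
    rw [← hm, ← hv, hσ2]
    field_simp
    ring
  set q : ℂ → ℕ → ℂ := fun τ i => ∑ j ∈ range (c (i + 1)),
    ((ρ ^ (i + 1) : ℝ) : ℂ) * Complex.exp (τ * (α ⟨i, j⟩ : ℝ) + τ ^ 2 * (β ⟨i, j⟩ : ℝ)) with hq
  have hqsum : ∀ τ, ∑ i ∈ range L, q τ i = ∑ b ∈ blocks L c,
      ((ρ ^ (b.1 + 1) : ℝ) : ℂ) * Complex.exp (τ * (α b : ℝ) + τ ^ 2 * (β b : ℝ)) := fun τ => by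
    rw [blocks, sum_sigma]
  have hqO : (fun τ : ℂ => ∑ i ∈ range L, q τ i - 1) =O[𝓝 0] fun τ => τ ^ 3 := by
    simp only [hqsum]
    refine sum_exp_cube_isBigO (blocks L c) _ _ _ ?_ ?_ ?_
    · exact_mod_cast hw1
    · exact_mod_cast hm1
    · exact_mod_cast hm2
  -- In this normalization the recursion has weights `q τ`, which equal `p` at `τ = 0` and have
  -- total `1 + O(τ³)`.
  set ψ : ℂ → ℕ → ℂ := fun τ k => ((ρ ^ k : ℝ) : ℂ) * Complex.exp (-((τ * μ + σ ^ 2 * τ ^ 2 / 2) * k)) *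
    expSum G k τ with hψ
  have hψrec : ∀ τ k, ψ τ (k + L) = ∑ i ∈ range L, q τ i * ψ τ (k + L - 1 - i) := by
    intro τ k
    simp only [hψ, hq]
    rw [h.expSum_rec, mul_sum]
    refine sum_congr rfl fun n hn => ?_
    have hnL := mem_range.1 hn
    rw [← mul_assoc, ← mul_assoc]
    congr 1
    rw [mul_sum, sum_mul]
    refine sum_congr rfl fun j _ => ?_
    have e : k + L = (n + 1) + (k + L - 1 - n) := by omega
    generalize k + L - 1 - n = r at e
    rw [e, pow_add, Complex.ofReal_mul]
    have e2 : -((τ * μ + σ ^ 2 * τ ^ 2 / 2) * ((n + 1 + r : ℕ) : ℂ)) + τ * blockSum c ⟨n, j⟩ =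
        (τ * (α ⟨n, j⟩ : ℝ) + τ ^ 2 * (β ⟨n, j⟩ : ℝ)) +
        -((τ * μ + σ ^ 2 * τ ^ 2 / 2) * r) := by
      simp only [hα, hβ]
      push_cast
      ring
    have e3 := congrArg Complex.exp e2
    rw [Complex.exp_add, Complex.exp_add] at e3
    linear_combination ((ρ ^ (n + 1) : ℝ) : ℂ) * ((ρ ^ r : ℝ) : ℂ) * e3
  have hψcont : ∀ k, Continuous fun τ => ψ τ k := fun k => by
    simp only [hψ, expSum]
    fun_prop
  have hψ0 : ∀ k, ψ 0 k = ((ρ ^ k * G (k + 1) : ℝ) : ℂ) := fun k => by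
    simp [hψ, expSum]
  set W := renewalMean L p (fun j => ψ 0 (L - 1 - j)) with hW
  obtain ⟨U, hU0, hUW⟩ : ∃ U : ℝ, 0 < U ∧ (U : ℂ) = W := by
    refine ⟨(∑ j ∈ range L, tailSum L p j * (ρ ^ (L - 1 - j) * G (L - 1 - j + 1))) /
      ∑ j ∈ range L, tailSum L p j, ?_, ?_⟩
    · have hts : ∀ j ∈ range L, 0 < tailSum L p j := fun j hj =>
        sum_pos (fun i hi => hppos i (mem_Ico.1 hi).2)
          ⟨j, mem_Ico.2 ⟨le_rfl, mem_range.1 hj⟩⟩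
      have hne : (range L).Nonempty := ⟨0, mem_range.2 h.length_pos⟩
      refine div_pos (sum_pos (fun j hj => ?_) hne) (sum_pos hts hne)
      have h1 := hts j hj
      have h2 : 0 < G (L - 1 - j + 1) := h.pos _ (by omega)
      positivity
    · simp only [hW, renewalMean, hψ0, Complex.real_smul]
      push_cast
      rfl
  have hmain : ∀ (ι : Type) (l : Filter ι) (N : ι → ℕ) (τ : ι → ℂ) (θ : ℂ), Tendsto N l atTop →
        Tendsto (fun s => τ s * (√(N s) : ℝ)) l (𝓝 θ) →
        Tendsto (fun s => ψ (τ s) (N s)) l (𝓝 U) := by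
    intro ι l N τ θ hN hτ
    obtain ⟨hτ0, hNτ⟩ := tendsto_of_mul_sqrt hN hτ
    rw [hUW]
    refine tendsto_perturbed_renewal h.length_pos hppos hroot (q := fun s => q (τ s))
      (h := fun s => ψ (τ s)) (fun i _ => ?_) ?_ hN (fun s k => hψrec (τ s) k)
      (fun j _ => ((hψcont j).tendsto 0).comp hτ0)
    · have hc : Continuous fun τ => q τ i := by simp only [hq]; fun_prop
      have h1 := (hc.tendsto 0).comp hτ0
      have h2 : q 0 i = (p i : ℂ) := by simp [hq, hp]
      rw [h2] at h1
      exact h1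
    · have h1 := (hqO.comp_tendsto hτ0).norm_left
      have h2 : (fun s => (N s : ℝ) * ‖∑ i ∈ range L, q (τ s) i - 1‖) =O[l]
          fun s => ((N s : ℂ) * τ s ^ 2) * τ s := by
        have h3 : (fun s => (N s : ℝ)) =O[l] fun s => (N s : ℂ) :=
          IsBigO.of_norm_right (by simpa using isBigO_refl _ _)
        refine (h3.mul h1).congr_right fun s => ?_
        simp only [Function.comp]
        ring
      refine h2.trans_tendsto ?_
      simpa using hNτ.mul hτ0
  -- At `τ = 0` the exponential sum merely counts.
  have hgrow : Tendsto (fun k : ℕ => ρ ^ k * (G (k + 1) : ℝ)) atTop (𝓝 U) := by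
    have h1 := hmain ℕ atTop id (fun _ => 0) 0 tendsto_id (by simp)
    simp only [hψ0, id] at h1
    exact_mod_cast (Complex.continuous_re.tendsto _).comp h1
  refine ⟨ρ, μ, σ, U, hρ0, hρ1, hσ0, hU0, hgrow, ?_⟩
  intro ι l N τ θ hN hτ
  have h1 := hmain ι l N τ θ hN hτ
  have h2 : Tendsto (fun s => ((ρ ^ N s * (G (N s + 1) : ℝ) : ℝ) : ℂ)) l (𝓝 U) :=
    (Complex.continuous_ofReal.tendsto U).comp (hgrow.comp hN)
  have hUne : (U : ℂ) ≠ 0 := by exact_mod_cast hU0.ne'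
  have h3 : Tendsto (fun s => Complex.exp (σ ^ 2 * ((N s : ℂ) * τ s ^ 2) / 2)) l
      (𝓝 (Complex.exp (σ ^ 2 * θ ^ 2 / 2))) := by
    refine (Complex.continuous_exp.tendsto _).comp ?_
    exact (((tendsto_of_mul_sqrt hN hτ).2).const_mul _).div_const _
  have h4 := (h1.div h2 hUne).mul h3
  rw [div_self hUne, one_mul] at h4
  refine h4.congr fun s => ?_
  have h5 : ((ρ ^ N s : ℝ) : ℂ) ≠ 0 := by exact_mod_cast (pow_pos hρ0 _).ne'
  have h6 : ((G (N s + 1) : ℝ) : ℂ) ≠ 0 := by exact_mod_cast (h.pos (N s + 1) (by omega)).ne'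
  have h7 : Complex.exp (-(τ s * μ * N s)) =
      Complex.exp (-((τ s * μ + σ ^ 2 * τ s ^ 2 / 2) * N s)) *
        Complex.exp (σ ^ 2 * ((N s : ℂ) * τ s ^ 2) / 2) := by
    rw [← Complex.exp_add]
    ring_nf
  simp only [hψ, Pi.div_apply]
  rw [h7, Complex.ofReal_mul]
  simp only [Complex.ofReal_natCast] at h6 ⊢
  field_simp

end IsMonotonePLRS

/-! ### From initial segments to windows -/

/-- If `[0, H)` is partitioned into short intervals on each of which the average of `f` is close
to `E`, then so is the average of `f` on a long interval. -/
theorem norm_sum_Ico_sub_le {κ : Type} [Fintype κ] {y len : κ → ℕ} {H w m m' : ℕ}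
    (hpart : ∀ (M : Type) [AddCommMonoid M] (f : ℕ → M),
      ∑ x ∈ range H, f x = ∑ i, ∑ t ∈ range (len i), f (y i + t))
    (hlen : ∀ i, len i ≤ w) (hm : m ≤ m') (hm' : m' ≤ H) {f : ℕ → ℂ} {E : ℂ} {ε C : ℝ}
    (hε : 0 ≤ ε) (hC : 0 ≤ C)
    (hE : ∀ i, ‖∑ t ∈ range (len i), f (y i + t) - len i * E‖ ≤ ε * len i)
    (hbd : ∀ i, ∑ t ∈ range (len i), ‖f (y i + t)‖ ≤ C * len i) :
    ‖∑ x ∈ Ico m m', f x - ((m' - m : ℕ) : ℂ) * E‖ ≤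
      ε * ((m' - m : ℕ) : ℝ) + (C + ‖E‖) * (4 * w) := by
  classical
  set I := Ico m m' with hI
  -- A piece that meets `I` without being contained in it crosses an endpoint, and so lies entirely
  -- in `B`.
  set B := Ico (m - w) (m + w) ∪ Ico (m' - w) (m' + w) with hB
  have hsumI : ∀ (M : Type) [AddCommMonoid M] (f : ℕ → M),
      ∑ x ∈ I, f x = ∑ i, ∑ t ∈ range (len i), if y i + t ∈ I then f (y i + t) else 0 := by
    intro M _ f
    rw [← hpart M fun x => if x ∈ I then f x else 0, ← sum_filter]
    congr 1
    ext x
    simp only [hI, mem_filter, mem_range, mem_Ico]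
    omega
  have hBcard : ∑ i, ∑ t ∈ range (len i), (if y i + t ∈ B then (1 : ℝ) else 0) ≤ 4 * w := by
    rw [← hpart ℝ fun x => if x ∈ B then (1 : ℝ) else 0, ← sum_filter, sum_const, nsmul_eq_mul,
      mul_one]
    have h1 : #{x ∈ range H | x ∈ B} ≤ #B := card_le_card fun x hx => (mem_filter.1 hx).2
    have h2 : #B ≤ 4 * w := by
      refine (card_union_le _ _).trans ?_
      rw [Nat.card_Ico, Nat.card_Ico]
      omega
    exact_mod_cast h1.trans h2
  have hIcard : ∑ i, ∑ t ∈ range (len i), (if y i + t ∈ I then (1 : ℝ) else 0) =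
      ((m' - m : ℕ) : ℝ) := by
    rw [← hsumI ℝ fun _ => (1 : ℝ)]
    simp [hI]
  have hmain : ∑ x ∈ I, f x - ((m' - m : ℕ) : ℂ) * E =
      ∑ i, ∑ t ∈ range (len i), if y i + t ∈ I then f (y i + t) - E else 0 := by
    rw [← hsumI ℂ fun x => f x - E, sum_sub_distrib]
    simp [hI]
  have hi : ∀ i, ‖∑ t ∈ range (len i), if y i + t ∈ I then f (y i + t) - E else 0‖ ≤
      ε * ∑ t ∈ range (len i), (if y i + t ∈ I then (1 : ℝ) else 0) +
      (C + ‖E‖) * ∑ t ∈ range (len i), (if y i + t ∈ B then (1 : ℝ) else 0) := by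
    intro i
    have hI0 : 0 ≤ ∑ t ∈ range (len i), (if y i + t ∈ I then (1 : ℝ) else 0) :=
      sum_nonneg fun t _ => by split_ifs <;> norm_num
    have hB0 : 0 ≤ ∑ t ∈ range (len i), (if y i + t ∈ B then (1 : ℝ) else 0) :=
      sum_nonneg fun t _ => by split_ifs <;> norm_num
    by_cases h1 : ∀ t < len i, y i + t ∈ I
    · have e1 : ∑ t ∈ range (len i), (if y i + t ∈ I then f (y i + t) - E else 0) =
          ∑ t ∈ range (len i), f (y i + t) - len i * E := by
        rw [sum_congr rfl fun t ht => if_pos (h1 t (mem_range.1 ht)), sum_sub_distrib]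
        simp
      have e2 : ∑ t ∈ range (len i), (if y i + t ∈ I then (1 : ℝ) else 0) = len i := by
        rw [sum_congr rfl fun t ht => if_pos (h1 t (mem_range.1 ht))]
        simp
      rw [e1, e2]
      refine (hE i).trans (le_add_of_nonneg_right (by positivity))
    by_cases h2 : ∀ t < len i, y i + t ∉ I
    · rw [sum_congr rfl fun t ht => if_neg (h2 t (mem_range.1 ht))]
      simp only [sum_const_zero, norm_zero]
      positivity
    · push Not at h1 h2
      obtain ⟨t₁, ht₁, hn⟩ := h1
      obtain ⟨t₂, ht₂, hp⟩ := h2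
      simp only [hI, mem_Ico] at hn hp
      have hw := hlen i
      have hB1 : ∀ t < len i, y i + t ∈ B := by
        intro t ht
        simp only [hB, mem_union, mem_Ico]
        omega
      have e2 : ∑ t ∈ range (len i), (if y i + t ∈ B then (1 : ℝ) else 0) = len i := by
        rw [sum_congr rfl fun t ht => if_pos (hB1 t (mem_range.1 ht))]
        simp
      rw [e2]
      have h3 : ‖∑ t ∈ range (len i), if y i + t ∈ I then f (y i + t) - E else 0‖ ≤
          (C + ‖E‖) * len i := by
        calc _ ≤ ∑ t ∈ range (len i), (‖f (y i + t)‖ + ‖E‖) := by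
              refine norm_sum_le_of_le _ fun t _ => ?_
              split_ifs
              · exact norm_sub_le _ _
              · simp only [norm_zero]; positivity
          _ ≤ _ := by
              rw [sum_add_distrib, add_mul]
              refine add_le_add (hbd i) ?_
              simp [mul_comm]
      refine h3.trans (le_add_of_nonneg_left (by positivity))
  rw [hmain]
  refine (norm_sum_le_of_le _ fun i _ => hi i).trans ?_
  rw [sum_add_distrib, ← mul_sum, ← mul_sum, hIcard]
  gcongr

namespace IsMonotonePLRS

variable {L : ℕ} {c G : ℕ → ℕ}

/-- Partition of `[0, G (k + 1))` into cylinders of level about `b`. -/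
theorem exists_cylinders (h : IsMonotonePLRS L c G) {b : ℕ} (hb : L ≤ b + 1) (k : ℕ)
    (hk : b + 1 ≤ k + L) :
    ∃ (κ : Type) (_ : Fintype κ) (y lev : κ → ℕ),
      (∀ i, b + 1 ≤ lev i + L ∧ lev i ≤ b ∧ y i + G (lev i + 1) ≤ G (k + 1) ∧
        greedyCount G (y i) + (∑ e ∈ range L, c (e + 1)) * lev i ≤
          (∑ e ∈ range L, c (e + 1)) * k ∧
        ∀ t < G (lev i + 1), greedyCount G (y i + t) = greedyCount G (y i) + greedyCount G t) ∧
      ∀ (M : Type) [AddCommMonoid M] (f : ℕ → M),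
        ∑ x ∈ range (G (k + 1)), f x = ∑ i, ∑ t ∈ range (G (lev i + 1)), f (y i + t) := by
  induction k using Nat.strong_induction_on with
  | _ k ih =>
  rcases Nat.lt_or_ge b k with hbk | hbk
  · have hL := h.length_pos
    set D := ∑ e ∈ range L, c (e + 1) with hD
    choose κ hκ y lev hy hsum using fun n : Fin L => ih (k - 1 - n) (by omega) (by omega)
    have e0 : ∀ n : Fin L, k - 1 - n + 1 = k - n := fun n => by omega
    have hcyl : ∀ (n : Fin L) (j : Fin (c (n + 1))) (i : κ n) (t : ℕ), t < G (lev n i + 1) →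
        ∑ e ∈ range n, c (e + 1) * G (k - e) + (j * G (k - n) + (y n i + t)) < G (k + 1) ∧
        greedyCount G (∑ e ∈ range n, c (e + 1) * G (k - e) + (j * G (k - n) + (y n i + t))) =
          ∑ e ∈ range n, c (e + 1) + j + (greedyCount G (y n i) + greedyCount G t) := by
      intro n j i t ht
      obtain ⟨h1, h2, h3, h4, h5⟩ := hy n i
      rw [← h5 t ht]
      exact h.greedyCount_cylinder n.2 (by omega) j.2 (by rw [← e0]; omega)
    refine ⟨Σ n : Fin L, Fin (c (n + 1)) × κ n, inferInstance,
      fun i => ∑ e ∈ range i.1, c (e + 1) * G (k - e) + (i.2.1 * G (k - i.1) + y i.1 i.2.2),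
      fun i => lev i.1 i.2.2, ?_, ?_⟩
    · rintro ⟨n, j, i⟩
      have hc := hcyl n j i
      obtain ⟨h1, h2, h3, h4, h5⟩ := hy n i
      have hpos : 0 < G (lev n i + 1) := h.pos _ (by omega)
      have hc0 := (hc 0 hpos).2
      simp only [Nat.add_zero, greedyCount_zero] at hc0
      refine ⟨h1, h2, ?_, ?_, fun t ht => ?_⟩
      · have := (hc (G (lev n i + 1) - 1) (by omega)).1
        dsimp only
        omega
      · dsimp only
        rw [hc0]
        -- A block has digit sum at most `D` and lowers the level by at least one, so prefixes
        -- accumulate at most `D` per level.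
        have h6 : ∑ e ∈ range n, c (e + 1) + j ≤ D := by
          have h7 : ∑ e ∈ range (n + 1), c (e + 1) ≤ D :=
            sum_le_sum_of_subset (range_mono n.2)
          rw [sum_range_succ] at h7
          have := j.2
          omega
        have h8 : D * (k - 1 - n) + D ≤ D * k := by
          calc D * (k - 1 - n) + D = D * (k - 1 - n + 1) := by ring
            _ ≤ D * k := Nat.mul_le_mul_left _ (by omega)
        omega
      · dsimp only
        rw [hc0, Nat.add_assoc, Nat.add_assoc, (hc t ht).2]
        omega
    · intro M _ f
      rw [h.sum_range_succ_cylinder (by omega), Fintype.sum_sigma, Finset.sum_range]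
      refine sum_congr rfl fun n _ => ?_
      rw [Fintype.sum_prod_type, Finset.sum_range]
      refine sum_congr rfl fun j _ => ?_
      have := hsum n M fun t => f (∑ e ∈ range n, c (e + 1) * G (k - e) + (j * G (k - n) + t))
      rw [e0] at this
      rw [this]
      simp only [Nat.add_assoc]
  · exact ⟨Unit, inferInstance, fun _ => 0, fun _ => k, fun _ => by
      simp [hk, hbk, greedyCount_zero], fun M _ f => by simp⟩

/-- The average of `exp (τ (s(x) - μ a))` over `x ∈ [m, m + G (a + 1))`. -/
noncomputable def windowTransform (G : ℕ → ℕ) (μ : ℝ) (a m : ℕ) (τ : ℂ) : ℂ :=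
  (∑ x ∈ Ico m (m + G (a + 1)), Complex.exp (τ * (greedyCount G x - μ * a))) / G (a + 1)

theorem tendsto_div_of_growth (h : IsMonotonePLRS L c G) {ρ U : ℝ} (hρ0 : 0 < ρ) (hρ1 : ρ < 1)
    (hU : 0 < U) (hgrow : Tendsto (fun k : ℕ => ρ ^ k * (G (k + 1) : ℝ)) atTop (𝓝 U))
    {ι : Type} {l : Filter ι} {u d : ι → ℕ} (hu : Tendsto u l atTop) (hd : Tendsto d l atTop) :
    Tendsto (fun s => (G (u s + 1) : ℝ) / G (u s + d s + 1)) l (𝓝 0) := by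
  have h1 := hgrow.comp hu
  have h2 := hgrow.comp (tendsto_atTop_mono (fun s => Nat.le_add_right (u s) (d s)) hu)
  have h3 : Tendsto (fun s => ρ ^ d s) l (𝓝 0) :=
    (tendsto_pow_atTop_nhds_zero_of_lt_one hρ0.le hρ1).comp hd
  have h4 := (h1.div h2 hU.ne').mul h3
  rw [mul_zero] at h4
  refine h4.congr fun s => ?_
  have h5 : (G (u s + d s + 1) : ℝ) ≠ 0 := by exact_mod_cast (h.pos _ (by omega)).ne'
  have h6 := hρ0.ne'
  simp only [Pi.div_apply, Function.comp, pow_add]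
  field_simp

/-- `|exp (τ u)| ≤ exp (|τ| u) + exp (-|τ| u)` for real `u`. Absolute sums, needed for the cylinders
cut by an endpoint, are thus controlled by the asymptotics at the real arguments `±|τ|`. -/
theorem sum_norm_exp_le (G : ℕ → ℕ) (μ : ℝ) (k : ℕ) (τ : ℂ) :
    ∑ t ∈ range (G (k + 1)), ‖Complex.exp (τ * (greedyCount G t - μ * k))‖ ≤
      ‖Complex.exp (-((‖τ‖ : ℂ) * μ * k)) * expSum G k ‖τ‖‖ +
      ‖Complex.exp (-((-‖τ‖ : ℂ) * μ * k)) * expSum G k (-‖τ‖)‖ := by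
  have e : ∀ r : ℝ, Complex.exp (-((r : ℂ) * μ * k)) * expSum G k r =
      ((∑ t ∈ range (G (k + 1)), Real.exp (r * (greedyCount G t - μ * k)) : ℝ) : ℂ) := by
    intro r
    rw [expSum, mul_sum]
    push_cast
    refine sum_congr rfl fun t _ => ?_
    rw [← Complex.exp_add]
    ring_nf
  have e1 := e ‖τ‖
  have e2 := e (-‖τ‖)
  rw [Complex.ofReal_neg] at e2
  have hn : ∀ r : ℝ, 0 ≤ ∑ t ∈ range (G (k + 1)), Real.exp (r * (greedyCount G t - μ * k)) :=
    fun r => sum_nonneg fun _ _ => (Real.exp_pos _).le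
  rw [e1, e2, Complex.norm_real, Complex.norm_real, Real.norm_of_nonneg (hn _),
    Real.norm_of_nonneg (hn _), ← sum_add_distrib]
  refine sum_le_sum fun t _ => ?_
  set u : ℝ := greedyCount G t - μ * k with hu
  have e3 : (greedyCount G t - μ * k : ℂ) = (u : ℂ) := by rw [hu]; push_cast; rfl
  rw [e3, Complex.norm_exp]
  have h1 : (τ * (u : ℂ)).re ≤ ‖τ‖ * |u| := by
    refine (Complex.re_le_norm _).trans ?_
    rw [norm_mul, Complex.norm_real, Real.norm_eq_abs]
  have h2 := Real.exp_le_exp.2 h1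
  rcases abs_cases u with ⟨h3, -⟩ | ⟨h3, -⟩ <;> rw [h3] at h2
  · linarith [Real.exp_pos (-‖τ‖ * u)]
  · rw [show ‖τ‖ * -u = -‖τ‖ * u by ring] at h2
    linarith [Real.exp_pos (‖τ‖ * u)]

/-- Each cylinder of level `lev` and prefix sum `r` contributes its own normalized exponential sum
times a recentring factor. The estimates are assumed for all admissible `lev` and `r`, rather than
for particular cylinders, so that a limit along a filter can supply them. -/
theorem norm_windowTransform_sub_le (h : IsMonotonePLRS L c G) {μ ε C : ℝ} {a b k m : ℕ}
    {τ E : ℂ} (hb : L ≤ b + 1) (hbk : b ≤ k) (hm : m + G (a + 1) ≤ G (k + 1)) (hε : 0 ≤ ε)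
    (hC0 : 0 ≤ C)
    (hyp : ∀ lev r : ℕ, b + 1 ≤ lev + L → lev ≤ b →
      r + (∑ e ∈ range L, c (e + 1)) * lev ≤ (∑ e ∈ range L, c (e + 1)) * k →
      ‖Complex.exp (τ * ((r : ℂ) - μ * ((a : ℂ) - lev))) *
        (Complex.exp (-(τ * μ * lev)) * expSum G lev τ / G (lev + 1)) - E‖ ≤ ε ∧
      ‖Complex.exp (-((‖τ‖ : ℂ) * μ * lev)) * expSum G lev ‖τ‖ / G (lev + 1)‖ +
        ‖Complex.exp (-((-‖τ‖ : ℂ) * μ * lev)) * expSum G lev (-‖τ‖) / G (lev + 1)‖ ≤ C ∧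
      ‖Complex.exp (τ * ((r : ℂ) - μ * ((a : ℂ) - lev)))‖ ≤ 2) :
    ‖windowTransform G μ a m τ - E‖ ≤
      ε + (G (b + 1) : ℝ) / G (a + 1) * ((2 * C + ‖E‖) * 4) := by
  have hL := h.length_pos
  obtain ⟨κ, _, y, lev, hy, hpart⟩ := h.exists_cylinders hb k (by omega)
  have hHpos : ∀ n, (0 : ℝ) < G (n + 1) := fun n => by exact_mod_cast h.pos (n + 1) (by omega)
  have hHne : ∀ n, (G (n + 1) : ℂ) ≠ 0 := fun n => by exact_mod_cast (h.pos (n + 1) (by omega)).ne'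
  have hyp' := fun i => hyp (lev i) (greedyCount G (y i)) (hy i).1 (hy i).2.1 (hy i).2.2.2.1
  have hf : ∀ i, ∀ t ∈ range (G (lev i + 1)),
      Complex.exp (τ * (greedyCount G (y i + t) - μ * a)) =
      Complex.exp (τ * ((greedyCount G (y i) : ℂ) - μ * ((a : ℂ) - lev i))) *
        Complex.exp (τ * (greedyCount G t - μ * lev i)) := by
    intro i t ht
    rw [(hy i).2.2.2.2 t (mem_range.1 ht), ← Complex.exp_add]
    push_cast
    ring_nf
  have hE : ∀ i, ‖∑ t ∈ range (G (lev i + 1)),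
      Complex.exp (τ * (greedyCount G (y i + t) - μ * a)) - G (lev i + 1) * E‖ ≤
      ε * G (lev i + 1) := by
    intro i
    have e1 : ∑ t ∈ range (G (lev i + 1)), Complex.exp (τ * (greedyCount G (y i + t) - μ * a)) =
        G (lev i + 1) * (Complex.exp (τ * ((greedyCount G (y i) : ℂ) - μ * ((a : ℂ) - lev i))) *
        (Complex.exp (-(τ * μ * lev i)) * expSum G (lev i) τ / G (lev i + 1))) := by
      rw [sum_congr rfl (hf i), ← mul_sum, mul_left_comm, mul_div_cancel₀ _ (hHne _), expSum]
      refine congrArg _ ?_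
      rw [mul_sum]
      refine sum_congr rfl fun t _ => ?_
      rw [← Complex.exp_add]
      ring_nf
    rw [e1, ← mul_sub, norm_mul, Complex.norm_natCast, mul_comm]
    exact mul_le_mul_of_nonneg_right (hyp' i).1 (Nat.cast_nonneg _)
  have hbd : ∀ i, ∑ t ∈ range (G (lev i + 1)),
      ‖Complex.exp (τ * (greedyCount G (y i + t) - μ * a))‖ ≤ 2 * C * G (lev i + 1) := by
    intro i
    have e2 : ∑ t ∈ range (G (lev i + 1)),
        ‖Complex.exp (τ * (greedyCount G (y i + t) - μ * a))‖ =
        ‖Complex.exp (τ * ((greedyCount G (y i) : ℂ) - μ * ((a : ℂ) - lev i)))‖ *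
        ∑ t ∈ range (G (lev i + 1)), ‖Complex.exp (τ * (greedyCount G t - μ * lev i))‖ := by
      rw [mul_sum]
      refine sum_congr rfl fun t ht => ?_
      rw [hf i t ht, norm_mul]
    rw [e2, mul_assoc]
    refine mul_le_mul (hyp' i).2.2 ?_ (sum_nonneg fun _ _ => norm_nonneg _) (by norm_num)
    refine (sum_norm_exp_le G μ (lev i) τ).trans ?_
    have h9 := (hyp' i).2.1
    rw [norm_div, norm_div, ← add_div, Complex.norm_natCast, div_le_iff₀ (hHpos _)] at h9
    exact h9
  have key := norm_sum_Ico_sub_le (w := G (b + 1)) hpart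
    (fun i => h.le_of_le (by omega) (by have := (hy i).2.1; omega)) (Nat.le_add_right m _) hm
    (f := fun x => Complex.exp (τ * (greedyCount G x - μ * a))) hε
    (mul_nonneg zero_le_two hC0) hE hbd
  rw [Nat.add_sub_cancel_left] at key
  have e1 : windowTransform G μ a m τ - E = (∑ x ∈ Ico m (m + G (a + 1)),
      Complex.exp (τ * (greedyCount G x - μ * a)) - G (a + 1) * E) / G (a + 1) := by
    rw [windowTransform, sub_div, mul_div_cancel_left₀ _ (hHne _)]
  rw [e1, norm_div, Complex.norm_natCast, div_le_iff₀ (hHpos _)]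
  refine key.trans (le_of_eq ?_)
  have := (hHpos a).ne'
  field_simp

/-- The transform of a window inside `[0, G (k + 1))` is Gaussian in the limit, when the level
`k` of the ambient interval exceeds the level `a` of the window by at most `q = o(√a)`. -/
theorem tendsto_windowTransform (h : IsMonotonePLRS L c G) {ρ μ σ U : ℝ} (hρ0 : 0 < ρ)
    (hρ1 : ρ < 1) (hU : 0 < U)
    (hgrow : Tendsto (fun k : ℕ => ρ ^ k * (G (k + 1) : ℝ)) atTop (𝓝 U))
    (hQ : ∀ (ι : Type) (l : Filter ι) (N : ι → ℕ) (τ : ι → ℂ) (θ : ℂ), Tendsto N l atTop →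
      Tendsto (fun s => τ s * (√(N s) : ℝ)) l (𝓝 θ) →
      Tendsto (fun s => Complex.exp (-(τ s * μ * N s)) * expSum G (N s) (τ s) / G (N s + 1)) l
        (𝓝 (Complex.exp (σ ^ 2 * θ ^ 2 / 2))))
    {ι : Type} {l : Filter ι} {a q k m : ι → ℕ} {τ : ι → ℂ} {θ : ℂ} (ha : Tendsto a l atTop)
    (hq : Tendsto q l atTop) (hqa : Tendsto (fun s => (q s : ℝ) / √(a s)) l (𝓝 0))
    (hk : ∀ᶠ s in l, k s ≤ a s + q s) (hm : ∀ᶠ s in l, m s + G (a s + 1) ≤ G (k s + 1))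
    (hτ : Tendsto (fun s => τ s * (√(a s) : ℝ)) l (𝓝 θ)) :
    Tendsto (fun s => windowTransform G μ (a s) (m s) (τ s)) l
      (𝓝 (Complex.exp (σ ^ 2 * θ ^ 2 / 2))) := by
  set E := Complex.exp (σ ^ 2 * θ ^ 2 / 2) with hE
  set D := ∑ e ∈ range L, c (e + 1) with hD
  have hL := h.length_pos
  have hsqrt : Tendsto (fun s => √(a s : ℝ)) l atTop :=
    Real.tendsto_sqrt_atTop.comp (tendsto_natCast_atTop_atTop.comp ha)
  have h2q : ∀ᶠ s in l, 2 * q s ≤ a s := by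
    filter_upwards [hqa.eventually (ge_mem_nhds (show (0 : ℝ) < 1 / 2 by norm_num)),
      hsqrt.eventually_ge_atTop 1] with s h1 h2
    rw [div_le_iff₀ (by linarith)] at h1
    have h3 : √(a s : ℝ) * √(a s) = a s := Real.mul_self_sqrt (Nat.cast_nonneg _)
    have : (2 * q s : ℝ) ≤ a s := by nlinarith
    exact_mod_cast this
  have hb : Tendsto (fun s => a s - q s) l atTop := by
    refine tendsto_atTop.2 fun B => ?_
    filter_upwards [h2q, ha.eventually_ge_atTop (2 * B)] with s h1 h2
    omega
  -- The admissible triples (index, level, prefix sum). A limit along `F` is a limit along `l`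
  -- uniform over all cylinders; `hFl` translates back.
  set P : Set (ι × ℕ × ℕ) := {p | (a p.1 - q p.1 + 1 ≤ p.2.1 + L ∧ p.2.1 ≤ a p.1 - q p.1) ∧
    p.2.2 + D * p.2.1 ≤ D * k p.1} with hP
  set F : Filter (ι × ℕ × ℕ) := comap Prod.fst l ⊓ 𝓟 P with hF
  have hfst : Tendsto Prod.fst F l := tendsto_comap.mono_left inf_le_left
  have hPF : ∀ᶠ p in F, p ∈ P := by
    rw [hF]
    exact mem_inf_of_right (mem_principal_self P)
  have hFl : ∀ {Q : ι × ℕ × ℕ → Prop}, (∀ᶠ p in F, Q p) →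
      ∀ᶠ s in l, ∀ p : ℕ × ℕ, (s, p) ∈ P → Q (s, p) := by
    intro Q hQ'
    rw [hF, eventually_inf_principal, eventually_comap] at hQ'
    exact hQ'.mono fun s hs p => hs (s, p) rfl
  have haF := ha.comp hfst
  have hlev : Tendsto (fun p : ι × ℕ × ℕ => p.2.1) F atTop := by
    refine tendsto_atTop.2 fun B => ?_
    filter_upwards [hPF, (hb.comp hfst).eventually_ge_atTop (B + L)] with p hp h2
    simp only [hP, Set.mem_ofPred_eq, Function.comp] at hp h2
    omega
  have hqL : Tendsto (fun s => ((q s : ℝ) + L) / √(a s)) l (𝓝 0) := by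
    have := hqa.add (hsqrt.const_div_atTop (L : ℝ))
    simp only [add_zero] at this
    exact this.congr fun s => (add_div _ _ _).symm
  have hgap : ∀ᶠ p in F, (p.2.1 : ℝ) ≤ a p.1 ∧ (a p.1 : ℝ) - p.2.1 ≤ q p.1 + L := by
    filter_upwards [hPF, hfst.eventually h2q] with p hp h2
    simp only [hP, Set.mem_ofPred_eq] at hp
    constructor
    · have : p.2.1 ≤ a p.1 := by omega
      exact_mod_cast this
    · rw [sub_le_iff_le_add]
      have : a p.1 ≤ q p.1 + L + p.2.1 := by omega
      exact_mod_cast this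
  have hratio : Tendsto (fun p : ι × ℕ × ℕ => (p.2.1 : ℝ) / a p.1) F (𝓝 1) := by
    have h1 : Tendsto (fun p : ι × ℕ × ℕ => 1 - (p.2.1 : ℝ) / a p.1) F (𝓝 0) := by
      refine squeeze_zero' ?_ ?_ (hqL.comp hfst)
      · filter_upwards [hgap] with p hp
        exact sub_nonneg.2 (div_le_one_of_le₀ hp.1 (Nat.cast_nonneg _))
      · filter_upwards [hgap, haF.eventually_ge_atTop 1] with p hp h1
        have h2 : (1 : ℝ) ≤ a p.1 := by exact_mod_cast h1
        have h3 : √(a p.1 : ℝ) ≤ a p.1 := by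
          rw [Real.sqrt_le_left (by linarith)]
          nlinarith
        have h4 : 0 < √(a p.1 : ℝ) := Real.sqrt_pos.2 (by linarith)
        rw [one_sub_div (by linarith)]
        simp only [Function.comp]
        have h5 : 0 ≤ (q p.1 : ℝ) + L := by positivity
        calc ((a p.1 : ℝ) - p.2.1) / a p.1 ≤ (q p.1 + L) / a p.1 := by
              gcongr; exact hp.2
          _ ≤ _ := by gcongr
    have h2 := h1.const_sub 1
    simpa using h2
  have hτF : Tendsto (fun p : ι × ℕ × ℕ => τ p.1 * (√(p.2.1 : ℝ) : ℝ)) F (𝓝 θ) := by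
    have h1 : Tendsto (fun p : ι × ℕ × ℕ => ((√((p.2.1 : ℝ) / a p.1) : ℝ) : ℂ)) F (𝓝 1) := by
      have := ((Complex.continuous_ofReal.comp Real.continuous_sqrt).tendsto 1).comp hratio
      simpa [Function.comp_def] using this
    have h2 := (hτ.comp hfst).mul h1
    rw [mul_one] at h2
    refine h2.congr' ?_
    filter_upwards [haF.eventually_ge_atTop 1] with p hp
    simp only [Function.comp] at hp ⊢
    have h3 : (0 : ℝ) < a p.1 := by exact_mod_cast hp
    rw [mul_assoc, ← Complex.ofReal_mul, ← Real.sqrt_mul h3.le, mul_div_cancel₀ _ h3.ne']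
  have hshift : Tendsto (fun p : ι × ℕ × ℕ => τ p.1 * ((p.2.2 : ℂ) - μ * ((a p.1 : ℂ) - p.2.1)))
      F (𝓝 0) := by
    have h1 : Tendsto (fun s => ‖τ s * (√(a s) : ℝ)‖ *
        ((D * 2 + |μ|) * (((q s : ℝ) + L) / √(a s)))) l (𝓝 0) := by
      simpa using hτ.norm.mul (hqL.const_mul (D * 2 + |μ|))
    refine squeeze_zero_norm' ?_ (h1.comp hfst)
    filter_upwards [hPF, hgap, hfst.eventually hk, hfst.eventually h2q,
      haF.eventually_ge_atTop 1] with p hp hg h2 h3 h4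
    simp only [hP, Set.mem_ofPred_eq] at hp
    have h5 : (0 : ℝ) < √(a p.1 : ℝ) := Real.sqrt_pos.2 (by exact_mod_cast h4)
    -- The prefix spans at most `k - lev ≤ 2 * (q + L)` levels, so it contributes `O(q) = o(√a)`.
    have h6 : (p.2.2 : ℝ) ≤ D * 2 * (q p.1 + L) := by
      have h7 : p.2.2 + D * p.2.1 ≤ D * (p.2.1 + 2 * (q p.1 + L)) :=
        hp.2.trans (Nat.mul_le_mul_left _ (by omega))
      have h8 : p.2.2 ≤ D * 2 * (q p.1 + L) := by
        rw [Nat.mul_add, ← Nat.mul_assoc] at h7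
        omega
      exact_mod_cast h8
    have h9 : ‖(p.2.2 : ℂ) - μ * ((a p.1 : ℂ) - p.2.1)‖ ≤ (D * 2 + |μ|) * (q p.1 + L) := by
      have e1 : (p.2.2 : ℂ) - μ * ((a p.1 : ℂ) - p.2.1) =
          (((p.2.2 : ℝ) - μ * ((a p.1 : ℝ) - p.2.1) : ℝ) : ℂ) := by push_cast; rfl
      rw [e1, Complex.norm_real, Real.norm_eq_abs]
      refine (abs_sub _ _).trans ?_
      rw [abs_mul, abs_of_nonneg (Nat.cast_nonneg _), abs_of_nonneg (sub_nonneg.2 hg.1), add_mul]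
      exact add_le_add h6 (mul_le_mul_of_nonneg_left hg.2 (abs_nonneg _))
    simp only [Function.comp]
    rw [norm_mul, norm_mul, Complex.norm_real, Real.norm_of_nonneg h5.le]
    calc ‖τ p.1‖ * ‖(p.2.2 : ℂ) - μ * ((a p.1 : ℂ) - p.2.1)‖
        ≤ ‖τ p.1‖ * ((D * 2 + |μ|) * (q p.1 + L)) := by gcongr
      _ = _ := by field_simp
  have hshiftexp : Tendsto (fun p : ι × ℕ × ℕ =>
      Complex.exp (τ p.1 * ((p.2.2 : ℂ) - μ * ((a p.1 : ℂ) - p.2.1)))) F (𝓝 1) := by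
    have := (Complex.continuous_exp.tendsto 0).comp hshift
    rwa [Complex.exp_zero] at this
  have hfull := hshiftexp.mul (hQ (ι × ℕ × ℕ) F (fun p => p.2.1) (fun p => τ p.1) θ hlev hτF)
  rw [one_mul, ← hE] at hfull
  have hτn : Tendsto (fun p : ι × ℕ × ℕ => ((‖τ p.1‖ : ℝ) : ℂ) * (√(p.2.1 : ℝ) : ℝ)) F
      (𝓝 (‖θ‖ : ℝ)) := by
    have := (Complex.continuous_ofReal.tendsto _).comp hτF.norm
    refine this.congr fun p => ?_
    simp only [Function.comp]
    rw [norm_mul, Complex.norm_real, Real.norm_of_nonneg (Real.sqrt_nonneg _),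
      Complex.ofReal_mul]
  have hplus := (hQ (ι × ℕ × ℕ) F (fun p => p.2.1) (fun p => ((‖τ p.1‖ : ℝ) : ℂ)) _ hlev hτn).norm
  have hminus := (hQ (ι × ℕ × ℕ) F (fun p => p.2.1) (fun p => -((‖τ p.1‖ : ℝ) : ℂ)) (-((‖θ‖ : ℝ) : ℂ)) hlev
    (by simpa only [neg_mul] using hτn.neg)).norm
  have hpm := hplus.add hminus
  have hbdd := hpm.eventually (ge_mem_nhds (lt_add_one _))
  obtain ⟨C, hC0, hC⟩ : ∃ C : ℝ, 0 ≤ C ∧ ∀ᶠ p in F,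
      ‖Complex.exp (-(((‖τ p.1‖ : ℝ) : ℂ) * μ * p.2.1)) * expSum G p.2.1 ((‖τ p.1‖ : ℝ) : ℂ) /
        G (p.2.1 + 1)‖ +
      ‖Complex.exp (-(-((‖τ p.1‖ : ℝ) : ℂ) * μ * p.2.1)) * expSum G p.2.1 (-((‖τ p.1‖ : ℝ) : ℂ)) /
        G (p.2.1 + 1)‖ ≤ C := by
    refine ⟨_, ?_, hbdd⟩
    positivity
  have hfac : ∀ᶠ p : ι × ℕ × ℕ in F,
      ‖Complex.exp (τ p.1 * ((p.2.2 : ℂ) - μ * ((a p.1 : ℂ) - p.2.1)))‖ ≤ 2 :=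
    hshiftexp.norm.eventually (ge_mem_nhds (show ‖(1 : ℂ)‖ < 2 by norm_num))
  have hHratio : Tendsto (fun s => (G (a s - q s + 1) : ℝ) / G (a s + 1)) l (𝓝 0) := by
    refine (h.tendsto_div_of_growth hρ0 hρ1 hU hgrow hb hq).congr' ?_
    filter_upwards [h2q] with s hs
    rw [show a s - q s + q s = a s by omega]
  rw [Metric.tendsto_nhds]
  intro ε hε
  have hε2 : 0 < ε / 2 := by linarith
  have hclose : ∀ᶠ p : ι × ℕ × ℕ in F,
      ‖Complex.exp (τ p.1 * ((p.2.2 : ℂ) - μ * ((a p.1 : ℂ) - p.2.1))) *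
        (Complex.exp (-(τ p.1 * μ * p.2.1)) * expSum G p.2.1 (τ p.1) / G (p.2.1 + 1)) - E‖ ≤
        ε / 2 := by
    have := (hfull.sub_const E).norm
    simp only [sub_self, norm_zero] at this
    exact this.eventually (ge_mem_nhds hε2)
  have hsmall : ∀ᶠ s in l, (G (a s - q s + 1) : ℝ) / G (a s + 1) * ((2 * C + ‖E‖) * 4) < ε / 2 := by
    have := hHratio.mul_const ((2 * C + ‖E‖) * 4)
    rw [zero_mul] at this
    exact this.eventually (gt_mem_nhds hε2)
  filter_upwards [hFl hclose, hFl hC, hFl hfac, hsmall, hm, hk, h2q, hb.eventually_ge_atTop L]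
    with s h1 h2 h3 h4 h5 h6 h7 h8
  have hak : a s - q s ≤ k s := by
    by_contra hc
    have := h.lt_of_lt (a := k s + 1) (b := a s + 1) (by omega) (by omega)
    omega
  rw [dist_eq_norm]
  refine (h.norm_windowTransform_sub_le (b := a s - q s) (by omega) hak h5 hε2.le hC0
    fun lev r hl1 hl2 hr => ?_).trans_lt (show _ < ε by linarith)
  have hp : (s, lev, r) ∈ P := ⟨⟨hl1, hl2⟩, hr⟩
  have h1' := h1 (lev, r) hp
  have h2' := h2 (lev, r) hp
  have h3' := h3 (lev, r) hp
  dsimp only at h1' h2' h3'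
  exact ⟨h1', h2', h3'⟩

end IsMonotonePLRS

/-! ### Moments and convergence in distribution -/

/-- The moments `∑ w ^ j exp (θ w) / H` of the exponentially tilted uniform distribution. -/
noncomputable def tiltedMoment (w : ℕ → ℝ) (m H j : ℕ) (θ : ℂ) : ℂ :=
  (∑ x ∈ Ico m (m + H), (w x : ℂ) ^ j * Complex.exp (θ * w x)) / H

theorem hasDerivAt_tiltedMoment (w : ℕ → ℝ) (m H j : ℕ) (θ : ℂ) :
    HasDerivAt (tiltedMoment w m H j) (tiltedMoment w m H (j + 1) θ) θ := by
  unfold tiltedMoment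
  refine HasDerivAt.div_const ?_ _
  refine HasDerivAt.fun_sum fun x _ => ?_
  have h1 : HasDerivAt (fun θ : ℂ => θ * (w x : ℂ)) (w x) θ := by
    simpa using (hasDerivAt_id θ).mul_const (w x : ℂ)
  have h2 := (h1.cexp).const_mul ((w x : ℂ) ^ j)
  refine h2.congr_deriv ?_
  ring

theorem tiltedMoment_zero_right (w : ℕ → ℝ) (m H j : ℕ) :
    tiltedMoment w m H j 0 = ((intervalMean (fun x => w x ^ j) m H : ℝ) : ℂ) := by
  simp [tiltedMoment, intervalMean]

/-- Convergence along `atTop ×ˢ 𝓝 θ` for every `θ` is locally uniform convergence of entire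
functions, which passes to derivatives by Weierstrass; the first two derivatives at `0` are the
moments. -/
theorem tendsto_moments {w : ℕ → ℕ → ℝ} {m H : ℕ → ℕ} {κ : ℂ}
    (hφ : ∀ θ : ℂ, Tendsto (fun p : ℕ × ℂ => tiltedMoment (w p.1) (m p.1) (H p.1) 0 p.2)
      (atTop ×ˢ 𝓝 θ) (𝓝 (Complex.exp (κ * θ ^ 2 / 2)))) :
    Tendsto (fun n => ((intervalMean (w n) (m n) (H n) : ℝ) : ℂ)) atTop (𝓝 0) ∧
    Tendsto (fun n => ((intervalMean (fun x => w n x ^ 2) (m n) (H n) : ℝ) : ℂ)) atTop (𝓝 κ) := by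
  have hg : ∀ θ : ℂ, HasDerivAt (fun θ : ℂ => Complex.exp (κ * θ ^ 2 / 2))
      (Complex.exp (κ * θ ^ 2 / 2) * (κ * θ)) θ := by
    intro θ
    have h1 : HasDerivAt (fun θ : ℂ => κ * θ ^ 2 / 2) (κ * θ) θ := by
      refine (((hasDerivAt_pow 2 θ).const_mul κ).div_const 2).congr_deriv ?_
      simp
      ring
    exact h1.cexp
  have hg2 : HasDerivAt (fun θ : ℂ => Complex.exp (κ * θ ^ 2 / 2) * (κ * θ)) κ 0 := by
    have h1 : HasDerivAt (fun θ : ℂ => κ * θ) κ 0 := by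
      simpa using (hasDerivAt_id (0 : ℂ)).const_mul κ
    exact ((hg 0).fun_mul h1).congr_deriv (by simp)
  have hdg : deriv (fun θ : ℂ => Complex.exp (κ * θ ^ 2 / 2)) =
      fun θ => Complex.exp (κ * θ ^ 2 / 2) * (κ * θ) := funext fun θ => (hg θ).deriv
  have hdm : ∀ n j, deriv (tiltedMoment (w n) (m n) (H n) j) =
      tiltedMoment (w n) (m n) (H n) (j + 1) :=
    fun n j => funext fun θ => (hasDerivAt_tiltedMoment _ _ _ _ _).deriv
  have hdiff : ∀ j, ∀ᶠ n in atTop, DifferentiableOn ℂ (tiltedMoment (w n) (m n) (H n) j)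
      Set.univ := fun j => .of_forall fun n θ _ =>
    (hasDerivAt_tiltedMoment _ _ _ _ _).differentiableAt.differentiableWithinAt
  have h0 : TendstoLocallyUniformlyOn (fun n => tiltedMoment (w n) (m n) (H n) 0)
      (fun θ : ℂ => Complex.exp (κ * θ ^ 2 / 2)) atTop Set.univ := by
    rw [tendstoLocallyUniformlyOn_univ, tendstoLocallyUniformly_iff_filter]
    intro θ
    rw [tendstoUniformlyOnFilter_iff_tendsto]
    refine Tendsto.mono_right ?_ (nhds_le_uniformity (Complex.exp (κ * θ ^ 2 / 2)))
    rw [nhds_prod_eq]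
    exact (((hg θ).continuousAt.tendsto).comp tendsto_snd).prodMk (hφ θ)
  have h1 := h0.deriv (hdiff 0) isOpen_univ
  have e1 : (deriv ∘ fun n => tiltedMoment (w n) (m n) (H n) 0) =
      fun n => tiltedMoment (w n) (m n) (H n) 1 := funext fun n => hdm n 0
  rw [e1, hdg] at h1
  have h2 := h1.deriv (hdiff 1) isOpen_univ
  have e2 : (deriv ∘ fun n => tiltedMoment (w n) (m n) (H n) 1) =
      fun n => tiltedMoment (w n) (m n) (H n) 2 := funext fun n => hdm n 1
  rw [e2] at h2
  have h3 := h1.tendsto_at (Set.mem_univ 0)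
  have h4 := h2.tendsto_at (Set.mem_univ 0)
  rw [hg2.deriv] at h4
  simp only [tiltedMoment_zero_right, pow_one, mul_zero] at h3 h4
  exact ⟨h3, h4⟩

theorem intervalMean_affine (f : ℕ → ℝ) (m : ℕ) {H : ℕ} (hH : 0 < H) (C A : ℝ) :
    intervalMean (fun x => C + A * f x) m H = C + A * intervalMean f m H := by
  have : (H : ℝ) ≠ 0 := by exact_mod_cast hH.ne'
  simp only [intervalMean, sum_add_distrib, sum_const, Nat.card_Ico, ← mul_sum,
    Nat.add_sub_cancel_left, nsmul_eq_mul]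
  field_simp

theorem intervalMean_sub_sq (f : ℕ → ℝ) (m : ℕ) {H : ℕ} (hH : 0 < H) :
    intervalMean (fun x => (f x - intervalMean f m H) ^ 2) m H =
      intervalMean (fun x => f x ^ 2) m H - intervalMean f m H ^ 2 := by
  have hne : (H : ℝ) ≠ 0 := by exact_mod_cast hH.ne'
  set M := intervalMean f m H with hM
  have h1 : ∑ x ∈ Ico m (m + H), f x = M * H := by
    rw [hM, intervalMean, div_mul_cancel₀ _ hne]
  have h2 : ∀ x, (f x - M) ^ 2 = f x ^ 2 - 2 * M * f x + M ^ 2 := fun x => by ring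
  simp only [intervalMean, h2, sum_add_distrib, sum_sub_distrib, ← mul_sum, h1, sum_const,
    Nat.card_Ico, Nat.add_sub_cancel_left, nsmul_eq_mul]
  field_simp
  ring

theorem intervalStdDev_affine (f : ℕ → ℝ) (m : ℕ) {H : ℕ} (hH : 0 < H) (C : ℝ) {A : ℝ}
    (hA : 0 ≤ A) : intervalStdDev (fun x => C + A * f x) m H = A * intervalStdDev f m H := by
  have h1 : ∀ x, (C + A * f x - (C + A * intervalMean f m H)) ^ 2 =
      0 + A ^ 2 * (f x - intervalMean f m H) ^ 2 := fun x => by ring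
  simp only [intervalStdDev, intervalMean_affine f m hH, h1]
  rw [intervalMean_affine (fun x => (f x - intervalMean f m H) ^ 2) m hH, zero_add,
    Real.sqrt_mul (sq_nonneg A), Real.sqrt_sq hA]

theorem normalizedCDF_affine (f : ℕ → ℝ) (m : ℕ) {H : ℕ} (hH : 0 < H) (C : ℝ) {A : ℝ}
    (hA : 0 < A) (t : ℝ) :
    normalizedCDF (fun x => C + A * f x) m H t = normalizedCDF f m H t := by
  have h1 : ∀ x, (C + A * f x - (C + A * intervalMean f m H)) / (A * intervalStdDev f m H) =
      (f x - intervalMean f m H) / intervalStdDev f m H := fun x => by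
    rw [show C + A * f x - (C + A * intervalMean f m H) = A * (f x - intervalMean f m H) by ring,
      mul_div_mul_left _ _ hA.ne']
  simp only [normalizedCDF, intervalStdDev_affine f m hH C hA.le, intervalMean_affine f m hH, h1]

open MeasureTheory in
/-- The distribution of `z x` for `x` uniform in `[m, m + H)`. -/
noncomputable def uniformLaw (z : ℕ → ℝ) (m H : ℕ) : Measure ℝ :=
  (H : ENNReal)⁻¹ • ∑ x ∈ Ico m (m + H), Measure.dirac (z x)

open MeasureTheory in
theorem isProbabilityMeasure_uniformLaw (z : ℕ → ℝ) (m : ℕ) {H : ℕ} (hH : 0 < H) :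
    IsProbabilityMeasure (uniformLaw z m H) := by
  constructor
  simp only [uniformLaw, Measure.smul_apply, Measure.finsetSum_apply, measure_univ, sum_const,
    Nat.card_Ico, Nat.add_sub_cancel_left, smul_eq_mul, nsmul_eq_mul, mul_one]
  exact ENNReal.inv_mul_cancel (by exact_mod_cast hH.ne') (ENNReal.natCast_ne_top H)

open MeasureTheory Classical in
theorem uniformLaw_real_Iic (z : ℕ → ℝ) (m H : ℕ) (t : ℝ) :
    (uniformLaw z m H).real (Set.Iic t) = (#{x ∈ Ico m (m + H) | z x ≤ t} : ℝ) / H := by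
  have h1 : ∀ x, Measure.dirac (z x) (Set.Iic t) = if z x ≤ t then (1 : ENNReal) else 0 :=
    fun x => by
      rw [Measure.dirac_apply' _ measurableSet_Iic]
      simp [Set.indicator_apply]
  rw [Measure.real, uniformLaw, Measure.smul_apply, Measure.finsetSum_apply]
  simp only [h1]
  rw [← sum_filter, sum_const, smul_eq_mul, nsmul_eq_mul, mul_one, ENNReal.toReal_mul,
    ENNReal.toReal_inv, ENNReal.toReal_natCast, ENNReal.toReal_natCast, mul_comm, div_eq_mul_inv]

open MeasureTheory in
theorem charFun_uniformLaw (z : ℕ → ℝ) (m H : ℕ) (t : ℝ) :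
    charFun (uniformLaw z m H) t =
      (∑ x ∈ Ico m (m + H), Complex.exp (t * z x * Complex.I)) / H := by
  rw [charFun_apply_real, uniformLaw, integral_smul_measure, integral_finsetSum_measure]
  · simp only [integral_dirac]
    rw [ENNReal.toReal_inv, ENNReal.toReal_natCast, Complex.real_smul, div_eq_inv_mul]
    push_cast
    rfl
  · intro x _
    exact integrable_dirac (by simp)

open MeasureTheory ProbabilityTheory in
/-- Convergence of the moment generating functions, uniformly near each complex argument, implies
that the normalized distribution functions converge to the normal one. -/
theorem tendsto_normalizedCDF {w : ℕ → ℕ → ℝ} {m H : ℕ → ℕ} {σ : ℝ} (hσ : 0 < σ)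
    (hH : ∀ n, 0 < H n)
    (hφ : ∀ θ : ℂ, Tendsto (fun p : ℕ × ℂ => tiltedMoment (w p.1) (m p.1) (H p.1) 0 p.2)
      (atTop ×ˢ 𝓝 θ) (𝓝 (Complex.exp (σ ^ 2 * θ ^ 2 / 2)))) (t : ℝ) :
    Tendsto (fun n => normalizedCDF (w n) (m n) (H n) t) atTop
      (𝓝 (cdf (gaussianReal 0 1) t)) := by
  obtain ⟨hm1, hm2⟩ := tendsto_moments hφ
  have hM1 : Tendsto (fun n => intervalMean (w n) (m n) (H n)) atTop (𝓝 0) := by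
    exact_mod_cast (Complex.continuous_re.tendsto _).comp hm1
  have hM2 : Tendsto (fun n => intervalMean (fun x => w n x ^ 2) (m n) (H n)) atTop
      (𝓝 (σ ^ 2)) := by
    have := (Complex.continuous_re.tendsto _).comp hm2
    rw [← Complex.ofReal_pow, Complex.ofReal_re] at this
    exact this
  have hsd : Tendsto (fun n => intervalStdDev (w n) (m n) (H n)) atTop (𝓝 σ) := by
    have h1 := (Real.continuous_sqrt.tendsto _).comp (hM2.sub (hM1.pow 2))
    have e : √(σ ^ 2 - 0 ^ 2) = σ := by
      rw [zero_pow two_ne_zero, sub_zero, Real.sqrt_sq hσ.le]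
    rw [e] at h1
    refine h1.congr fun n => ?_
    rw [intervalStdDev, intervalMean_sub_sq _ _ (hH n)]
    rfl
  set z : ℕ → ℕ → ℝ := fun n x =>
    (w n x - intervalMean (w n) (m n) (H n)) / intervalStdDev (w n) (m n) (H n) with hz
  have hprob : ∀ n, IsProbabilityMeasure (uniformLaw (z n) (m n) (H n)) := fun n =>
    isProbabilityMeasure_uniformLaw _ _ (hH n)
  let ν : ℕ → ProbabilityMeasure ℝ := fun n => ⟨uniformLaw (z n) (m n) (H n), hprob n⟩
  let ν₀ : ProbabilityMeasure ℝ := ⟨gaussianReal 0 1, inferInstance⟩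
  have hcf : Tendsto ν atTop (𝓝 ν₀) := by
    rw [ProbabilityMeasure.tendsto_iff_tendsto_charFun]
    intro u
    have hlim : charFun (ν₀ : Measure ℝ) u = Complex.exp (-((u * 0 / σ : ℝ) : ℂ) * Complex.I) *
        Complex.exp (σ ^ 2 * (((u / σ : ℝ) : ℂ) * Complex.I) ^ 2 / 2) := by
      change charFun (gaussianReal 0 1) u = _
      rw [charFun_gaussianReal, ← Complex.exp_add]
      congr 1
      have : (σ : ℂ) ≠ 0 := by exact_mod_cast hσ.ne'
      rw [mul_pow, Complex.I_sq]
      push_cast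
      field_simp
      simp
      ring
    rw [hlim]
    have h1 : Tendsto (fun n => u / intervalStdDev (w n) (m n) (H n)) atTop (𝓝 (u / σ)) :=
      tendsto_const_nhds.div hsd hσ.ne'
    have h2 : Tendsto (fun n => ((u / intervalStdDev (w n) (m n) (H n) : ℝ) : ℂ) * Complex.I)
        atTop (𝓝 (((u / σ : ℝ) : ℂ) * Complex.I)) :=
      ((Complex.continuous_ofReal.tendsto _).comp h1).mul_const _
    -- The argument `i u / sd` varies with `n` because the actual standard deviation is used;
    -- uniformity near the limit argument absorbs this.
    have h3 := (hφ _).comp (tendsto_id.prodMk h2)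
    have h4 : Tendsto (fun n => u * intervalMean (w n) (m n) (H n) /
        intervalStdDev (w n) (m n) (H n)) atTop (𝓝 (u * 0 / σ)) :=
      (hM1.const_mul u).div hsd hσ.ne'
    have h5 : Tendsto (fun n => Complex.exp (-((u * intervalMean (w n) (m n) (H n) /
        intervalStdDev (w n) (m n) (H n) : ℝ) : ℂ) * Complex.I)) atTop
        (𝓝 (Complex.exp (-((u * 0 / σ : ℝ) : ℂ) * Complex.I))) :=
      (Complex.continuous_exp.tendsto _).comp
        ((((Complex.continuous_ofReal.tendsto _).comp h4).neg).mul_const _)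
    refine (h5.mul h3).congr fun n => ?_
    change _ = charFun (uniformLaw (z n) (m n) (H n)) u
    rw [charFun_uniformLaw]
    simp only [Function.comp, id, tiltedMoment, pow_zero, one_mul]
    rw [← mul_div_assoc, mul_sum]
    congr 1
    refine sum_congr rfl fun x _ => ?_
    rw [← Complex.exp_add, hz]
    congr 1
    push_cast
    ring
  -- The Gaussian law has no atoms, so every half-line is a continuity set.
  have hfr : (ν₀ : Measure ℝ) (frontier (Set.Iic t)) = 0 := by
    change gaussianReal 0 1 (frontier (Set.Iic t)) = 0
    have := nullSingletonClass_gaussianReal (μ := 0) (v := 1) one_ne_zero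
    rw [frontier_Iic]
    exact measure_singleton t
  have h6 := ProbabilityMeasure.tendsto_measure_of_null_frontier_of_tendsto' hcf hfr
  have h7 := (ENNReal.tendsto_toReal (measure_ne_top _ _)).comp h6
  rw [cdf_eq_real]
  refine h7.congr fun n => ?_
  change (uniformLaw (z n) (m n) (H n)).real (Set.Iic t) = _
  rw [uniformLaw_real_Iic]
  rfl

/-! ### The exceptional set and the conclusion -/

/-- An auxiliary sequence `q → ∞` with `q = o(√a)` and `q ≤ d`. -/
theorem exists_slow_sequence {a d : ℕ → ℕ} (ha : Tendsto a atTop atTop)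
    (hd : Tendsto d atTop atTop) : ∃ q : ℕ → ℕ, Tendsto q atTop atTop ∧
      Tendsto (fun n => (q n : ℝ) / √(a n)) atTop (𝓝 0) ∧ ∀ n, q n ≤ d n := by
  -- The fourth root gives `q² ≤ √a`, hence `q / √a ≤ 1 / q`.
  set q : ℕ → ℕ := fun n => min (Nat.sqrt (Nat.sqrt (a n))) (d n) with hq
  have hqt : Tendsto q atTop atTop := by
    refine tendsto_atTop.2 fun B => ?_
    filter_upwards [ha.eventually_ge_atTop (B * B * (B * B)), hd.eventually_ge_atTop B]
      with n h1 h2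
    exact le_min (Nat.le_sqrt.2 (Nat.le_sqrt.2 h1)) h2
  refine ⟨q, hqt, ?_, fun n => min_le_right _ _⟩
  have h0 : Tendsto (fun n => (1 : ℝ) / q n) atTop (𝓝 0) :=
    (tendsto_natCast_atTop_atTop.comp hqt).const_div_atTop 1
  refine squeeze_zero' (.of_forall fun n => by positivity) ?_ h0
  filter_upwards [hqt.eventually_ge_atTop 1] with n hn
  have h1 : q n * q n ≤ Nat.sqrt (a n) := Nat.le_sqrt.1 (min_le_left _ _)
  have h2 : (q n : ℝ) * q n ≤ √(a n) :=
    (by exact_mod_cast h1 : (q n : ℝ) * q n ≤ Nat.sqrt (a n)).trans Real.nat_sqrt_le_real_sqrt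
  have h3 : (1 : ℝ) ≤ q n := by exact_mod_cast hn
  have h4 : 0 < √(a n : ℝ) := by nlinarith
  rw [div_le_div_iff₀ h4 (by linarith)]
  linarith

/-- The window `[x, x + G (a + 1))` lies in a cylinder of level at most `B`. -/
def InCylinder (G : ℕ → ℕ) (a B x : ℕ) : Prop :=
  ∃ Y k, k ≤ B ∧ Y ≤ x ∧ x + G (a + 1) ≤ Y + G (k + 1) ∧
    ∀ t < G (k + 1), greedyCount G (Y + t) = greedyCount G Y + greedyCount G t

namespace IsMonotonePLRS

variable {L : ℕ} {c G : ℕ → ℕ}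

open Classical in
-- In a cylinder of the partition, whose level lies between `B + 1 - L` and `B`, only the last `G (a
-- + 1)` starting points can fail.
theorem card_not_inCylinder_le (h : IsMonotonePLRS L c G) {a B k : ℕ} (hB : L ≤ B + 1)
    (hk : B + 1 ≤ k + L) :
    (#{x ∈ range (G (k + 1)) | ¬ InCylinder G a B x} : ℝ) ≤
      (G (a + 1) : ℝ) / G (B + 1 - L + 1) * G (k + 1) := by
  obtain ⟨κ, _, y, lev, hy, hpart⟩ := h.exists_cylinders hB k hk
  have hlen : (G (k + 1) : ℝ) = ∑ i, (G (lev i + 1) : ℝ) := by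
    simpa using hpart ℝ fun _ => 1
  have hcard : (#{x ∈ range (G (k + 1)) | ¬ InCylinder G a B x} : ℝ) =
      ∑ i, (#{t ∈ range (G (lev i + 1)) | ¬ InCylinder G a B (y i + t)} : ℝ) := by
    have := hpart ℝ fun x => if ¬ InCylinder G a B x then 1 else 0
    simpa only [← sum_filter, sum_const, nsmul_eq_mul, mul_one] using this
  rw [hcard, hlen, mul_sum]
  refine sum_le_sum fun i _ => ?_
  obtain ⟨h1, h2, h3, h4, h5⟩ := hy i
  have hsub : {t ∈ range (G (lev i + 1)) | ¬ InCylinder G a B (y i + t)} ⊆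
      Ico (G (lev i + 1) - G (a + 1)) (G (lev i + 1)) := by
    intro t ht
    rw [mem_filter, mem_range] at ht
    refine mem_Ico.2 ⟨?_, ht.1⟩
    by_contra hc
    exact ht.2 ⟨y i, lev i, h2, Nat.le_add_right _ _, by omega, h5⟩
  have hc := card_le_card hsub
  rw [Nat.card_Ico] at hc
  have hc' : (#{t ∈ range (G (lev i + 1)) | ¬ InCylinder G a B (y i + t)} : ℝ) ≤ G (a + 1) := by
    exact_mod_cast hc.trans (by omega)
  refine hc'.trans ?_
  have hpos : (0 : ℝ) < G (B + 1 - L + 1) := by exact_mod_cast h.pos _ (by omega)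
  have hle : (G (B + 1 - L + 1) : ℝ) ≤ G (lev i + 1) := by
    exact_mod_cast h.le_of_le (by omega) (by omega)
  rw [div_mul_eq_mul_div, le_div_iff₀ hpos]
  gcongr

/-- `G n / G (n + 1) → ρ < 1`. So a set negligible in `[0, G (n + 1))` is also negligible relative
to `[G n, G (n + 1))`. -/
theorem eventually_le_sub (h : IsMonotonePLRS L c G) {ρ U : ℝ} (hρ0 : 0 < ρ) (hρ1 : ρ < 1)
    (hU : 0 < U) (hgrow : Tendsto (fun k : ℕ => ρ ^ k * (G (k + 1) : ℝ)) atTop (𝓝 U)) :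
    ∀ᶠ n in atTop, (1 - ρ) / 2 * (G (n + 1) : ℝ) ≤ (G (n + 1) : ℝ) - G n := by
  have h1 : Tendsto (fun k : ℕ => (G (k + 1) : ℝ) / G (k + 1 + 1)) atTop (𝓝 ρ) := by
    have h2 := (hgrow.div ((tendsto_add_atTop_iff_nat 1).2 hgrow) hU.ne').mul_const ρ
    rw [div_self hU.ne', one_mul] at h2
    refine h2.congr fun k => ?_
    have h3 : (G (k + 1 + 1) : ℝ) ≠ 0 := by exact_mod_cast (h.pos _ (by omega)).ne'
    have h4 := hρ0.ne'
    simp only [Pi.div_apply, pow_succ]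
    field_simp
  have h2 := (tendsto_add_atTop_iff_nat (f := fun n => (G n : ℝ) / G (n + 1)) 1).1 h1
  filter_upwards [h2.eventually (ge_mem_nhds (show ρ < (1 + ρ) / 2 by linarith))] with n hn
  have h3 : (0 : ℝ) < G (n + 1) := by exact_mod_cast h.pos _ (by omega)
  rw [div_le_iff₀ h3] at hn
  linarith

theorem tiltedMoment_eq_windowTransform {μ r : ℝ} {a m k Y : ℕ} (hY : Y ≤ m)
    (hm : m + G (a + 1) ≤ Y + G (k + 1))
    (hcyl : ∀ t < G (k + 1), greedyCount G (Y + t) = greedyCount G Y + greedyCount G t) (θ : ℂ) :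
    tiltedMoment (fun x => (greedyCount G x - greedyCount G Y - μ * a) / r) m (G (a + 1)) 0 θ =
      windowTransform G μ a (m - Y) (θ / r) := by
  rw [tiltedMoment, windowTransform]
  congr 1
  have e : Ico m (m + G (a + 1)) = Ico (m - Y + Y) (m - Y + G (a + 1) + Y) := by
    congr 1 <;> omega
  rw [e, ← Finset.sum_Ico_add' _ (m - Y) (m - Y + G (a + 1)) Y]
  refine sum_congr rfl fun x hx => ?_
  have hx' := mem_Ico.1 hx
  rw [add_comm x Y, hcyl x (by omega)]
  push_cast
  rw [pow_zero, one_mul]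
  congr 1
  ring

end IsMonotonePLRS

theorem theorem1p2 (L : ℕ) (c G : ℕ → ℕ) (hG : IsPLRS L c G)
    (hmono : ∀ i j, 1 ≤ i → i ≤ j → j ≤ L → c j ≤ c i) (hone : 1 ≤ c L)
    (α : ℕ → ℕ) (hα : Tendsto α atTop atTop)
    (hnα : Tendsto (fun n : ℕ => (n : ℤ) - (α n : ℤ)) atTop atTop) :
    ∃ E : ℕ → Finset ℕ,
      (∀ n, E n ⊆ Ico (G n) (G (n + 1))) ∧
      (fun n => (#(E n) : ℝ)) =o[atTop] (fun n => (G (n + 1) : ℝ) - (G n : ℝ)) ∧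
      ∀ m : ℕ → ℕ, (∀ᶠ n in atTop, m n ∈ Ico (G n) (G (n + 1)) \ E n) →
        ∀ t : ℝ,
          Tendsto
            (fun n => normalizedCDF (fun x => (numSummands L c G x : ℝ)) (m n) (G (α n)) t)
            atTop (𝓝 (ProbabilityTheory.cdf (ProbabilityTheory.gaussianReal 0 1) t)) := by
  by_cases htriv : L = 1 ∧ c 1 = 1
  -- Here `G` is constant from index 1 on, so no admissible `m` exists.
  · obtain ⟨rfl, hc1⟩ := htriv
    refine ⟨fun _ => ∅, fun _ => empty_subset _, by simp, ?_⟩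
    intro m hm t
    obtain ⟨n, hn, hn1⟩ := (hm.and (eventually_ge_atTop 1)).exists
    have h1 := hG.recurrence n hn1
    simp only [Icc_self, sum_singleton, hc1, one_mul, Nat.add_sub_cancel] at h1
    rw [h1] at hn
    simp at hn
  have h : IsMonotonePLRS L c G :=
    { hG with
      anti := hmono
      lt_succ := hG.lt_succ_of_ne (fun i hi hL => hone.trans (hmono i L hi hL le_rfl)) htriv }
  obtain ⟨ρ, μ, σ, U, hρ0, hρ1, hσ, hU, hgrow, hQ⟩ := h.exists_quasiPower
  have hfun : (fun x => (numSummands L c G x : ℝ)) = fun x => (greedyCount G x : ℝ) :=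
    funext fun x => by rw [h.numSummands_eq]
  rw [hfun]
  -- Level `a` corresponds to length `G (a + 1)`. The truncation at `α n = 0` is harmless because `α
  -- n → ∞`.
  set a : ℕ → ℕ := fun n => α n - 1 with ha
  have hat : Tendsto a atTop atTop := (tendsto_sub_atTop_nat 1).comp hα
  have hdt : Tendsto (fun n => n - α n) atTop atTop := by
    refine tendsto_atTop.2 fun B => ?_
    filter_upwards [hnα.eventually_ge_atTop (B : ℤ)] with n hn
    omega
  obtain ⟨q, hqt, hqa, hqd⟩ := exists_slow_sequence hat hdt
  have hαn : ∀ᶠ n in atTop, α n ≤ n := by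
    filter_upwards [hnα.eventually_ge_atTop 0] with n hn
    omega
  classical
  refine ⟨fun n => {x ∈ Ico (G n) (G (n + 1)) | ¬ InCylinder G (a n) (a n + q n) x},
    fun n => filter_subset _ _, ?_, ?_⟩
  · have hd : Tendsto (fun n => q n + 1 - L) atTop atTop := by
      refine tendsto_atTop.2 fun B => ?_
      filter_upwards [hqt.eventually_ge_atTop (B + L)] with n hn
      omega
    have hsmall := h.tendsto_div_of_growth hρ0 hρ1 hU hgrow hat hd
    rw [isLittleO_iff]
    intro ε hε
    have hε' : 0 < ε * ((1 - ρ) / 2) := mul_pos hε (by linarith)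
    filter_upwards [hsmall.eventually (ge_mem_nhds hε'), h.eventually_le_sub hρ0 hρ1 hU hgrow,
      hαn, hqt.eventually_ge_atTop L] with n h1 h2 h3 h4
    have hqn := hqd n
    have hLpos := h.length_pos
    have han : a n = α n - 1 := rfl

    have h5 := h.card_not_inCylinder_le (a := a n) (B := a n + q n) (k := n) (by omega)
      (by omega)
    rw [show a n + q n + 1 - L = a n + (q n + 1 - L) by omega] at h5
    have h6 : (#{x ∈ Ico (G n) (G (n + 1)) | ¬ InCylinder G (a n) (a n + q n) x} : ℝ) ≤
        #{x ∈ range (G (n + 1)) | ¬ InCylinder G (a n) (a n + q n) x} := by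
      refine Nat.cast_le.2 (card_le_card (filter_subset_filter _ ?_))
      intro x hx
      exact mem_range.2 (mem_Ico.1 hx).2
    have hG0 : (0 : ℝ) ≤ G (n + 1) := Nat.cast_nonneg _
    rw [Real.norm_of_nonneg (Nat.cast_nonneg _), Real.norm_of_nonneg (le_trans (mul_nonneg
      (by linarith) hG0) h2)]
    calc _ ≤ _ := h6
      _ ≤ _ := h5
      _ ≤ ε * ((1 - ρ) / 2) * G (n + 1) := by gcongr
      _ = ε * ((1 - ρ) / 2 * G (n + 1)) := by ring
      _ ≤ _ := by gcongr
  · intro m hm t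
    have hex : ∀ n, ∃ Y k, InCylinder G (a n) (a n + q n) (m n) →
        k ≤ a n + q n ∧ Y ≤ m n ∧ m n + G (a n + 1) ≤ Y + G (k + 1) ∧
        ∀ t < G (k + 1), greedyCount G (Y + t) = greedyCount G Y + greedyCount G t := by
      intro n
      by_cases hn : InCylinder G (a n) (a n + q n) (m n)
      · obtain ⟨Y, k, hYk⟩ := hn
        exact ⟨Y, k, fun _ => hYk⟩
      · exact ⟨0, 0, fun hc => absurd hc hn⟩
    choose Y k hYk using hex
    have hev : ∀ᶠ n in atTop, InCylinder G (a n) (a n + q n) (m n) := by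
      filter_upwards [hm] with n hn
      rw [Finset.mem_sdiff, mem_filter] at hn
      by_contra hc
      exact hn.2 ⟨hn.1, hc⟩
    -- An affine change of `s` that uses the cylinder's base point; the normalized distribution
    -- function is unaffected by it.
    set w : ℕ → ℕ → ℝ := fun n x =>
      (greedyCount G x - greedyCount G (Y n) - μ * a n) / √(a n) with hw
    have hHpos : ∀ n, 0 < G (a n + 1) := fun n => h.pos _ (by omega)
    have hφ : ∀ θ : ℂ, Tendsto
        (fun p : ℕ × ℂ => tiltedMoment (w p.1) (m p.1) (G (a p.1 + 1)) 0 p.2)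
        (atTop ×ˢ 𝓝 θ) (𝓝 (Complex.exp (σ ^ 2 * θ ^ 2 / 2))) := by
      intro θ
      have hfst : Tendsto Prod.fst (atTop ×ˢ 𝓝 θ : Filter (ℕ × ℂ)) atTop := tendsto_fst
      have hτ : Tendsto (fun p : ℕ × ℂ => p.2 / (√(a p.1) : ℝ) * (√(a p.1) : ℝ))
          (atTop ×ˢ 𝓝 θ) (𝓝 θ) := by
        refine tendsto_snd.congr' ?_
        filter_upwards [(hat.comp hfst).eventually_ge_atTop 1] with p hp
        simp only [Function.comp] at hp
        have h1 : √(a p.1 : ℝ) ≠ 0 := (Real.sqrt_pos.2 (by exact_mod_cast hp)).ne'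
        have h2 : ((√(a p.1 : ℝ) : ℝ) : ℂ) ≠ 0 := by exact_mod_cast h1
        rw [div_mul_cancel₀ _ h2]
      have key := h.tendsto_windowTransform hρ0 hρ1 hU hgrow hQ (l := atTop ×ˢ 𝓝 θ)
        (a := fun p => a p.1) (q := fun p => q p.1) (k := fun p => k p.1)
        (m := fun p => m p.1 - Y p.1) (τ := fun p => p.2 / (√(a p.1) : ℝ)) (hat.comp hfst)
        (hqt.comp hfst) (hqa.comp hfst)
        (by filter_upwards [hfst.eventually hev] with p hp using (hYk p.1 hp).1)
        (by
          filter_upwards [hfst.eventually hev] with p hp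
          obtain ⟨-, h1, h2, -⟩ := hYk p.1 hp
          omega) hτ
      refine key.congr' ?_
      filter_upwards [hfst.eventually hev] with p hp
      obtain ⟨-, h1, h2, h3⟩ := hYk p.1 hp
      exact (IsMonotonePLRS.tiltedMoment_eq_windowTransform h1 h2 h3 p.2).symm
    refine (tendsto_normalizedCDF hσ hHpos hφ t).congr' ?_
    filter_upwards [hα.eventually_ge_atTop 2] with n hn
    have hA : 0 < √(a n : ℝ) := Real.sqrt_pos.2 (by
      have : 0 < a n := by simp only [ha]; omega
      exact_mod_cast this)
    rw [← normalizedCDF_affine (w n) (m n) (hHpos n) (greedyCount G (Y n) + μ * a n) hA t]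
    have e1 : a n + 1 = α n := by simp only [ha]; omega
    have e2 : (fun x => (greedyCount G (Y n) : ℝ) + μ * a n + √(a n) * w n x) =
        fun x => (greedyCount G x : ℝ) := by
      funext x
      simp only [hw]
      field_simp
      ring
    rw [e1, e2]
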